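/- **Theorem 2.1.** Let $\mathcal H$ be a separable real Hilbert space with its Borel $\sigma$-algebra, let $A:\mathcal H\to 2^{\mathcal H}$ be maximally monotone, let $B:\mathcal H\to\mathcal H$ be monotone, let $C:\mathcal H\to\mathcal H$ be $\beta$-cocoercive with $\beta>0$, i.e. $\langle Cu-Cv,u-v\rangle\ge\beta\|Cu-Cv\|^2$ for all $u,v\in\mathcal H$, and assume that $Z=\{x\in\mathcal H: 0\in Ax+Bx+Cx\}$ is nonempty. Let $Q$ be a probability distribution on a measurable index space $I$ and $(i,x)\mapsto B_i(x)\in\mathcal H$ a jointly measurable map such that, for $\xi\sim Q$ and some $L\ge 0$, one has $\mathbb E[B_\xi(x)]=B(x)$ for all $x\in\mathcal H$ (with $B_\xi(x)$ integrable) and $\mathbb E\|B_\xi(u)-B_\xi(v)\|^2\le L^2\|u-v\|^2$ for all $u,v\in\mathcal H$. Let $\lambda\in[0,1)$, $p\in(0,1]$ and $$0<\gamma<\frac{4\beta(1-\lambda)}{1+\sqrt{1+16\beta^2L^2(1-\lambda)}} .$$ On a probability space $(\Omega,\mathcal F,P)$ let $\xi_0,\xi_1,\dots$ be $I$-valued random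 variables with law $Q$ and $c_0,c_1,\dots$ be random variables that are "true" with probability $p$ and "false" with probability $1-p$, all of them mutually independent. Given a point $x^0=w^0\in\mathcal H$, let for $k=0,1,\dots$ $$\bar x^k=\lambda x^k+(1-\lambda)w^k,\qquad y^k=J_{\gamma A}\big(\bar x^k-\gamma(B+C)w^k\big),\qquad x^{k+1}=y^k+\gamma\big(B_{\xi_k}w^k-B_{\xi_k}y^k\big),$$ $$w^{k+1}=\begin{cases}x^{k+1}&\text{if } c_k \text{ is true,}\\ w^k&\text{if } c_k\text{ is false,}\end{cases}$$ where $J_{\gamma A}=(\mathrm{Id}+\gamma A)^{-1}$. Put $\Phi_k(x)=\lambda\|x^k-x\|^2+\frac{1-\lambda}{p}\|w^k-x\|^2$ and $\mathbb E_k[\cdot]=\mathbb E[\,\cdot\mid\sigma(\xi_0,\dots,\xi_{k-1},w^0,\dots,w^k)]$. Then the $x^k$ and $w^k$ are random variables, and for every $x^*\in Z$ and every $k\ge 0$ the random variable $\Phi_k(x^*)$ is integrable and $$\mathbb E_k[\Phi_{k+1}(x^*)]\le\Phi_k(x^*)\quad\text{almost surely.}$$ Moreover, there is a $Z$-valued random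 variable $\bar x$ such that, almost surely, $x^k$ converges weakly to $\bar x$. -/

import Mathlib

open MeasureTheory ProbabilityTheory Filter Topology
open scoped RealInnerProductSpace

namespace VRFBHF

section Operators

variable {H : Type*} [NormedAddCommGroup H] [InnerProductSpace ℝ H]

/-- A set-valued operator `A : H → 2^H` is maximally monotone: `(x, u)` lies in its graph if and
only if it is monotonically related to every point of the graph. -/
def MaximallyMonotone (A : H → Set H) : Prop :=
  ∀ x u : H, u ∈ A x ↔ ∀ y v : H, v ∈ A y → 0 ≤ ⟪u - v, x - y⟫

/-- A point-valued operator is monotone. -/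
def MonotoneOp (B : H → H) : Prop :=
  ∀ x y : H, 0 ≤ ⟪B x - B y, x - y⟫

/-- `C` is `β`-cocoercive, with `β > 0`. -/
def Cocoercive (β : ℝ) (C : H → H) : Prop :=
  0 < β ∧ ∀ x y : H, β * ‖C x - C y‖ ^ 2 ≤ ⟪C x - C y, x - y⟫

/-- The solution set of the inclusion `0 ∈ A x + B x + C x`. -/
def solutionSet (A : H → Set H) (B C : H → H) : Set H :=
  {x | ∃ a ∈ A x, a + B x + C x = 0}

/-- The resolvent `J_{γA} = (Id + γ A)⁻¹`, the inverse being that of a set-valued operator: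
`y ∈ J_{γA} z` if and only if `z ∈ y + γ A y`. For `A` maximally monotone and `γ > 0` the set
`J_{γA} z` is a singleton. -/
def resolventOp (γ : ℝ) (A : H → Set H) (z : H) : Set H :=
  {y | ∃ a ∈ A y, y + γ • a = z}

end Operators

section Oracle

variable {H : Type*} [NormedAddCommGroup H] [InnerProductSpace ℝ H] [MeasurableSpace H]
  {I : Type*} [MeasurableSpace I]

/-- `Bo i x` stands for `B_i(x)`. The oracle `Bo`, with index drawn from `Q`, is an unbiased
stochastic oracle of `B` that is `L`-Lipschitz in mean. -/
structure IsOracle (Q : Measure I) (Bo : I → H → H) (B : H → H) (L : ℝ) : Prop where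
  measurable : Measurable (fun q : I × H => Bo q.1 q.2)
  integrable : ∀ x : H, Integrable (fun i => Bo i x) Q
  unbiased : ∀ x : H, ∫ i, Bo i x ∂Q = B x
  integrable_sq : ∀ u v : H, Integrable (fun i => ‖Bo i u - Bo i v‖ ^ 2) Q
  lipschitz_in_mean : ∀ u v : H, ∫ i, ‖Bo i u - Bo i v‖ ^ 2 ∂Q ≤ L ^ 2 * ‖u - v‖ ^ 2

end Oracle

section Algorithm

variable {Ω : Type*} {I : Type*} {H : Type*}

/-- The randomness of the algorithm: the indices `ξ k` have law `Q`, the coins `c k` show `true`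
with probability `p`, and all the variables `ξ 0, c 0, ξ 1, c 1, …` are mutually independent
(the pairs `(ξ k, c k)` are independent of each other, and so are the two entries of each
pair). -/
structure IsSampling [MeasurableSpace Ω] [MeasurableSpace I] (P : Measure Ω) (Q : Measure I)
    (p : ℝ) (ξ : ℕ → Ω → I) (c : ℕ → Ω → Bool) : Prop where
  measurable_index : ∀ k, Measurable (ξ k)
  measurable_coin : ∀ k, Measurable (c k)
  law_index : ∀ k, P.map (ξ k) = Q
  law_coin : ∀ k, P.real {ω | c k ω = true} = p
  indep_index_coin : ∀ k, IndepFun (ξ k) (c k) P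
  indep_pairs : iIndepFun (fun k ω => (ξ k ω, c k ω)) P

/-- `x`, `y`, `w` are iterates of the algorithm started at `x₀`, run with the indices `ξ k` and the
coins `c k`. -/
structure IsIterates [NormedAddCommGroup H] [InnerProductSpace ℝ H]
    (A : H → Set H) (B C : H → H) (Bo : I → H → H) (lam γ : ℝ) (x₀ : H)
    (ξ : ℕ → Ω → I) (c : ℕ → Ω → Bool) (x y w : ℕ → Ω → H) : Prop where
  init_x : ∀ ω, x 0 ω = x₀
  init_w : ∀ ω, w 0 ω = x₀
  step_y : ∀ k ω, y k ω ∈ resolventOp γ A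
    ((lam • x k ω + (1 - lam) • w k ω) - γ • (B (w k ω) + C (w k ω)))
  step_x : ∀ k ω, x (k + 1) ω = y k ω + γ • (Bo (ξ k ω) (w k ω) - Bo (ξ k ω) (y k ω))
  step_w : ∀ k ω, w (k + 1) ω = if c k ω = true then x (k + 1) ω else w k ω

/-- The σ-algebra `σ(ξ_0, …, ξ_{k-1}, w^0, …, w^k)` of the information available before step `k`.
-/
abbrev history [MeasurableSpace I] [MeasurableSpace H] (ξ : ℕ → Ω → I) (w : ℕ → Ω → H) (k : ℕ) :
    MeasurableSpace Ω :=
  (⨆ j ∈ Finset.range k, MeasurableSpace.comap (ξ j) inferInstance) ⊔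
    (⨆ j ∈ Finset.range (k + 1), MeasurableSpace.comap (w j) inferInstance)

/-- The Lyapunov function `Φ_k(z) = λ ‖x^k - z‖² + ((1 - λ) / p) ‖w^k - z‖²`. -/
noncomputable def lyapunov [NormedAddCommGroup H] (lam p : ℝ) (x w : ℕ → Ω → H) (k : ℕ) (z : H)
    (ω : Ω) : ℝ :=
  lam * ‖x k ω - z‖ ^ 2 + (1 - lam) / p * ‖w k ω - z‖ ^ 2

end Algorithm

end VRFBHF

/-! Let z be a solution. Monotonicity of A and B, together with cocoercivity of C and Young's
inequality, bounds ‖y^k - z‖² plus the correction terms by λ‖x^k - z‖² + (1 - λ)‖w^k - z‖² - δ‖w^k -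
y^k‖², where δ = 1 - λ - γ²L² - γ/(2β) (`norm_sq_resolvent_step_le`). The bound on γ makes δ
positive. Averaging over ξ_k turns the correction terms into a bound for the mean of ‖x^{k+1} - z‖².
Averaging over the coin c_k, with the weight (1 - λ)/p in Φ, gives E_k Φ_{k+1}(z) + δ‖w^k - y^k‖² ≤
Φ_k(z) (`IsIterates.setLIntegral_lyapunov_succ_le`).

Hence Φ_k(z) is a nonnegative supermartingale and converges almost surely, and the mean squares of
w^k - y^k are summable. Those of x^{k+1} - y^k are then summable too, so almost surely both
differences vanish, and with them x^k - w^k. Consequently ‖x^k - z‖ converges, first for z in a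
countable dense subset of Z and then for every z in Z. Weak cluster points lie in Z because the
graph of A + B + C is closed for weak convergence of points and strong convergence of values
(`MaximallyMonotone.zero_mem_of_weak_limit`). Opial's lemma gives the weak limit, and a Pettis-type
argument makes it measurable. -/

namespace VRFBHF

/-! ### Resolvents of maximally monotone operators: Minty's theorem and closedness of the graph -/

section Minty

theorem norm_sq_convexComb_sub {E : Type*} [NormedAddCommGroup E] [InnerProductSpace ℝ E]
    (s : ℝ) (z z' q : E) :
    ‖(1 - s) • z + s • z' - q‖ ^ 2
      = (1 - s) * ‖z - q‖ ^ 2 + s * ‖z' - q‖ ^ 2 - s * (1 - s) * ‖z' - z‖ ^ 2 := by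
  have h1 : (1 - s) • z + s • z' - q = (1 - s) • (z - q) + s • (z' - q) := by module
  have h2 : z' - z = (z' - q) - (z - q) := by abel
  rw [h1, h2, norm_add_sq_real, norm_sub_sq_real (z' - q), norm_smul, norm_smul, mul_pow, mul_pow,
    inner_smul_left, inner_smul_right, Real.norm_eq_abs, Real.norm_eq_abs, sq_abs, sq_abs,
    real_inner_comm (z - q)]
  simp only [conj_trivial]
  ring

/-- A supremum of functions `‖· - q a‖² - r a` that is bounded below attains its minimum, with
quadratic growth. -/
theorem exists_minimizer_iSup_sq_dist {E : Type*} [NormedAddCommGroup E] [InnerProductSpace ℝ E]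
    [CompleteSpace E] {ι : Type*} (q : ι → E) (r : ι → ℝ)
    (hne : ∃ z t, ∀ a, ‖z - q a‖ ^ 2 ≤ t + r a)
    (hb : ∀ z t, (∀ a, ‖z - q a‖ ^ 2 ≤ t + r a) → 0 ≤ t) :
    ∃ z₀ m, (∀ a, ‖z₀ - q a‖ ^ 2 ≤ m + r a) ∧
      ∀ z t, (∀ a, ‖z - q a‖ ^ 2 ≤ t + r a) → m + ‖z - z₀‖ ^ 2 ≤ t := by
  set T : Set ℝ := {t | ∃ z, ∀ a, ‖z - q a‖ ^ 2 ≤ t + r a} with hT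
  have hTne : T.Nonempty := by
    obtain ⟨z, t, h⟩ := hne
    exact ⟨t, z, h⟩
  have hTb : BddBelow T := ⟨0, fun t ⟨z, h⟩ => hb z t h⟩
  set m := sInf T with hm
  -- Strong convexity of the supremum: every function ‖· - q a‖² has the same quadratic defect along
  -- a segment, so the defect survives the supremum over a.
  have key : ∀ s : ℝ, 0 ≤ s → s ≤ 1 → ∀ z t z' t', (∀ a, ‖z - q a‖ ^ 2 ≤ t + r a) →
      (∀ a, ‖z' - q a‖ ^ 2 ≤ t' + r a) →
      m ≤ (1 - s) * t + s * t' - s * (1 - s) * ‖z' - z‖ ^ 2 := by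
    intro s hs hs1 z t z' t' h h'
    refine csInf_le hTb ⟨(1 - s) • z + s • z', fun a => ?_⟩
    rw [norm_sq_convexComb_sub]
    have := mul_le_mul_of_nonneg_left (h a) (sub_nonneg.2 hs1)
    have := mul_le_mul_of_nonneg_left (h' a) hs
    linarith
  have hex : ∀ n : ℕ, ∃ z, ∀ a, ‖z - q a‖ ^ 2 ≤ m + 1 / ((n : ℝ) + 1) + r a := by
    intro n
    obtain ⟨t, ⟨z, hz⟩, ht⟩ := exists_lt_of_csInf_lt hTne
      (show sInf T < m + 1 / ((n : ℝ) + 1) by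
        have : (0 : ℝ) < 1 / ((n : ℝ) + 1) := by positivity
        linarith)
    exact ⟨z, fun a => (hz a).trans (by linarith)⟩
  choose zs hzs using hex
  have hdist : ∀ n k N : ℕ, N ≤ n → N ≤ k → dist (zs n) (zs k) ^ 2 ≤ 4 * (1 / ((N : ℝ) + 1)) := by
    intro n k N hn hk
    have h := key (1 / 2) (by norm_num) (by norm_num) _ _ _ _ (hzs k) (hzs n)
    have h1 := Nat.one_div_le_one_div (α := ℝ) hn
    have h2 := Nat.one_div_le_one_div (α := ℝ) hk
    rw [dist_eq_norm]
    linarith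
  have hcau : CauchySeq zs := by
    refine cauchySeq_of_le_tendsto_0 (fun N : ℕ => Real.sqrt (4 * (1 / ((N : ℝ) + 1)))) ?_ ?_
    · intro n k N hn hk
      exact Real.le_sqrt_of_sq_le (hdist n k N hn hk)
    · have : Tendsto (fun N : ℕ => 4 * (1 / ((N : ℝ) + 1))) atTop (𝓝 (4 * 0)) :=
        tendsto_one_div_add_atTop_nhds_zero_nat.const_mul 4
      simpa using this.sqrt
  obtain ⟨z₀, hz₀⟩ := cauchySeq_tendsto_of_complete hcau
  have hmem : ∀ a, ‖z₀ - q a‖ ^ 2 ≤ m + r a := by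
    intro a
    have h1 : Tendsto (fun n => ‖zs n - q a‖ ^ 2) atTop (𝓝 (‖z₀ - q a‖ ^ 2)) :=
      ((hz₀.sub_const _).norm).pow 2
    have h2 : Tendsto (fun n : ℕ => m + 1 / ((n : ℝ) + 1) + r a) atTop (𝓝 (m + 0 + r a)) :=
      (tendsto_one_div_add_atTop_nhds_zero_nat.const_add m).add_const _
    simpa using le_of_tendsto_of_tendsto' h1 h2 fun n => hzs n a
  refine ⟨z₀, m, hmem, fun z t hz => ?_⟩
  -- Quadratic growth: `key` on the segment from z₀ to z, divided by s, with s = 1/(n+1) tending to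
  -- 0.
  have hlim : Tendsto (fun n : ℕ => m + (1 - 1 / ((n : ℝ) + 1)) * ‖z - z₀‖ ^ 2) atTop
      (𝓝 (m + (1 - 0) * ‖z - z₀‖ ^ 2)) :=
    ((tendsto_one_div_add_atTop_nhds_zero_nat.const_sub 1).mul_const _).const_add m
  rw [sub_zero, one_mul] at hlim
  refine le_of_tendsto' hlim fun n => ?_
  set s : ℝ := 1 / ((n : ℝ) + 1) with hs
  have hs0 : 0 < s := by positivity
  have hs1 : s ≤ 1 := by
    rw [hs, div_le_one (by positivity)]
    linarith [n.cast_nonneg (α := ℝ)]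
  have h := key s hs0.le hs1 z₀ m z t hmem hz
  have h' : s * (m + (1 - s) * ‖z - z₀‖ ^ 2) ≤ s * t := by linarith
  exact le_of_mul_le_mul_left h' hs0

variable {H : Type*} [NormedAddCommGroup H] [InnerProductSpace ℝ H]

theorem MaximallyMonotone.monotone {A : H → Set H} (hA : MaximallyMonotone A) {x u y v : H}
    (hu : u ∈ A x) (hv : v ∈ A y) : 0 ≤ ⟪u - v, x - y⟫ :=
  (hA x u).1 hu y v hv

theorem MaximallyMonotone.exists_mem {A : H → Set H} (hA : MaximallyMonotone A) :
    ∃ x u, u ∈ A x := by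
  by_contra! h
  exact h 0 0 ((hA 0 0).2 fun y v hv => absurd hv (h y v))

/-- The Fitzpatrick inequality. -/
theorem MaximallyMonotone.sq_norm_add_le {A : H → Set H} (hA : MaximallyMonotone A) {x u : H}
    {t : ℝ} (h : ∀ y v, v ∈ A y → ‖x + v‖ ^ 2 + ‖u + y‖ ^ 2 ≤ t + ‖y + v‖ ^ 2) :
    ‖x + u‖ ^ 2 ≤ t := by
  by_cases hx : u ∈ A x
  · have := h x u hx
    rw [add_comm u x] at this
    linarith
  · rw [hA x u] at hx
    push Not at hx
    -- For this pair, ‖x+v‖² + ‖u+y‖² - ‖y+v‖² - ‖x+u‖² = -2⟪u-v, x-y⟫ > 0.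
    obtain ⟨y, v, hv, hlt⟩ := hx
    have := h y v hv
    simp only [norm_add_sq_real, inner_sub_left, inner_sub_right] at *
    rw [real_inner_comm x u, real_inner_comm x v, real_inner_comm y v] at hlt
    linarith

/-- **Minty's theorem** at the origin. -/
theorem MaximallyMonotone.exists_neg_mem [CompleteSpace H] {A : H → Set H}
    (hA : MaximallyMonotone A) : ∃ x, -x ∈ A x := by
  let ι := {q : H × H // q.2 ∈ A q.1}
  have hn : ∀ (z : WithLp 2 (H × H)) (a : ι),
      ‖z - WithLp.toLp 2 (-a.1.2, -a.1.1)‖ ^ 2 = ‖z.fst + a.1.2‖ ^ 2 + ‖z.snd + a.1.1‖ ^ 2 := by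
    intro z a
    rw [WithLp.prod_norm_sq_eq_of_L2]
    simp
  have hself : ∀ x u, u ∈ A x → ∀ a : ι,
      ‖x + a.1.2‖ ^ 2 + ‖u + a.1.1‖ ^ 2 ≤ ‖x + u‖ ^ 2 + ‖a.1.1 + a.1.2‖ ^ 2 := by
    rintro x u hu ⟨⟨y, v⟩, hv⟩
    have := hA.monotone hu hv
    simp only [norm_add_sq_real, inner_sub_left, inner_sub_right] at *
    rw [real_inner_comm x u, real_inner_comm x v, real_inner_comm y v] at this
    linarith
  -- The supremum being minimized is ‖x‖² + ‖u‖² + 2F(x, u), with F the Fitzpatrick function of A.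
  -- It dominates ‖x+u‖² everywhere and does not exceed it on the graph.
  obtain ⟨z₀, m, hz₀, hmin⟩ := exists_minimizer_iSup_sq_dist
    (fun a : ι => (WithLp.toLp 2 (-a.1.2, -a.1.1) : WithLp 2 (H × H)))
    (fun a : ι => ‖a.1.1 + a.1.2‖ ^ 2)
    (by
      obtain ⟨x, u, hu⟩ := hA.exists_mem
      exact ⟨WithLp.toLp 2 (x, u), ‖x + u‖ ^ 2, fun a => by simpa [hn] using hself x u hu a⟩)
    (by
      intro z t h
      refine le_trans (sq_nonneg _) (hA.sq_norm_add_le (x := z.fst) (u := z.snd) fun y v hv => ?_)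
      have h' := h ⟨(y, v), hv⟩
      rwa [hn] at h')
  have hm : ‖z₀.fst + z₀.snd‖ ^ 2 ≤ m :=
    hA.sq_norm_add_le fun y v hv => by
      have h := hz₀ ⟨(y, v), hv⟩
      rwa [hn] at h
  have hopt : ∀ x u, u ∈ A x →
      m + (‖x - z₀.fst‖ ^ 2 + ‖u - z₀.snd‖ ^ 2) ≤ ‖x + u‖ ^ 2 := by
    intro x u hu
    have := hmin (WithLp.toLp 2 (x, u)) (‖x + u‖ ^ 2)
      fun a => by rw [hn]; exact hself x u hu a
    rwa [WithLp.prod_norm_sq_eq_of_L2] at this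
  generalize z₀.fst = x₀ at *
  generalize z₀.snd = u₀ at *
  -- Quadratic growth makes (-u₀, -x₀) monotonically related to the whole graph, with margin
  -- ‖x₀+u₀‖². By maximality the pair lies in the graph, and testing it against itself forces the
  -- margin to vanish.
  have hrel : ∀ x u, u ∈ A x → ‖x₀ + u₀‖ ^ 2 ≤ ⟪-x₀ - u, -u₀ - x⟫ := by
    intro x u hu
    have h := hopt x u hu
    simp only [norm_add_sq_real, norm_sub_sq_real, inner_sub_left, inner_sub_right,
      inner_neg_left, inner_neg_right] at *
    rw [real_inner_comm x u, real_inner_comm x x₀]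
    linarith
  have hmem : -x₀ ∈ A (-u₀) := (hA _ _).2 fun y v hv => (sq_nonneg _).trans (hrel y v hv)
  have h0 := hrel _ _ hmem
  rw [sub_self, inner_zero_left] at h0
  have : x₀ + u₀ = 0 := by
    have : ‖x₀ + u₀‖ = 0 := by nlinarith [norm_nonneg (x₀ + u₀)]
    exact norm_eq_zero.1 this
  have hu : -u₀ = x₀ := by rw [neg_eq_iff_add_eq_zero, add_comm]; exact this
  exact ⟨x₀, hu ▸ hmem⟩

/-- **Minty's theorem**: the resolvent of a maximally monotone operator is defined everywhere. -/
theorem MaximallyMonotone.resolventOp_nonempty [CompleteSpace H] {A : H → Set H}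
    (hA : MaximallyMonotone A) {γ : ℝ} (hγ : 0 < γ) (z : H) : (resolventOp γ A z).Nonempty := by
  -- The operator γA - z: a point x with -x in its image satisfies z ∈ x + γAx.
  have hA' : MaximallyMonotone fun x => {u | γ⁻¹ • (u + z) ∈ A x} := by
    intro x u
    have hscale : ∀ y v, ⟪γ⁻¹ • (u + z) - γ⁻¹ • (v + z), x - y⟫ = γ⁻¹ * ⟪u - v, x - y⟫ := by
      intro y v
      rw [← smul_sub, add_sub_add_right_eq_sub, real_inner_smul_left]
    rw [Set.mem_ofPred_eq, hA]
    constructor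
    · intro h y v hv
      have := h y _ hv
      rw [hscale] at this
      exact nonneg_of_mul_nonneg_right this (inv_pos.2 hγ)
    · intro h y v hv
      have hv' : γ⁻¹ • ((γ • v - z) + z) = v := by
        rw [sub_add_cancel, inv_smul_smul₀ hγ.ne']
      have := h y (γ • v - z) (by rw [Set.mem_ofPred_eq, hv']; exact hv)
      have h2 := hscale y (γ • v - z)
      rw [hv'] at h2
      rw [h2]
      exact mul_nonneg (inv_pos.2 hγ).le this
  obtain ⟨x, hx⟩ := hA'.exists_neg_mem
  refine ⟨x, _, hx, ?_⟩
  rw [smul_inv_smul₀ hγ.ne']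
  abel

/-- The resolvent is nonexpansive. -/
theorem MaximallyMonotone.norm_sub_le_of_mem_resolventOp {A : H → Set H}
    (hA : MaximallyMonotone A) {γ : ℝ} (hγ : 0 < γ) {z z' y y' : H} (hy : y ∈ resolventOp γ A z)
    (hy' : y' ∈ resolventOp γ A z') : ‖y - y'‖ ≤ ‖z - z'‖ := by
  obtain ⟨a, ha, rfl⟩ := hy
  obtain ⟨a', ha', rfl⟩ := hy'
  have h := hA.monotone ha ha'
  have h1 : y + γ • a - (y' + γ • a') = (y - y') + γ • (a - a') := by module
  refine le_of_sq_le_sq ?_ (norm_nonneg _)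
  rw [h1, norm_add_sq_real, inner_smul_right, real_inner_comm]
  have := mul_nonneg hγ.le h
  nlinarith [sq_nonneg ‖γ • (a - a')‖]

/-- For `D` Lipschitz, the equation `v = J_{εA} (y - ε D v)` is solvable for small `ε`. -/
theorem MaximallyMonotone.exists_forward_backward_eq [CompleteSpace H] {A : H → Set H}
    (hA : MaximallyMonotone A) {D : H → H} {K : NNReal} (hD : LipschitzWith K D) (y : H) :
    ∃ ε > (0 : ℝ), ∃ v, ∃ a ∈ A v, v + ε • (a + D v) = y := by
  -- This choice gives εK ≤ 1/2, hence a contraction, and the summand 1 allows K = 0.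
  set ε : ℝ := 1 / (2 * (K + 1)) with hε
  have hε0 : 0 < ε := by positivity
  have hne := fun z => hA.resolventOp_nonempty hε0 z
  choose J hJ using hne
  have hc : ContractingWith (1 / 2) fun v => J (y - ε • D v) := by
    refine ⟨by
      rw [← NNReal.coe_lt_coe]
      norm_num, LipschitzWith.of_dist_le_mul fun v v' => ?_⟩
    rw [dist_eq_norm]
    refine (hA.norm_sub_le_of_mem_resolventOp hε0 (hJ _) (hJ _)).trans ?_
    have h1 : y - ε • D v - (y - ε • D v') = - (ε • (D v - D v')) := by module
    rw [h1, norm_neg, norm_smul, Real.norm_eq_abs, abs_of_pos hε0, ← dist_eq_norm]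
    have h2 := hD.dist_le_mul v v'
    have h3 : ε * K ≤ 1 / 2 := by
      rw [hε, div_mul_eq_mul_div, div_le_div_iff₀ (by positivity) (by norm_num)]
      nlinarith [K.coe_nonneg]
    calc ε * dist (D v) (D v') ≤ ε * (K * dist v v') := by gcongr
      _ = ε * K * dist v v' := by ring
      _ ≤ 1 / 2 * dist v v' := by gcongr
      _ = _ := by simp
  have hfix := hc.fixedPoint_isFixedPt
  set v := hc.fixedPoint
  obtain ⟨a, ha, h⟩ := hJ (y - ε • D v)
  have hv : J (y - ε • D v) = v := hfix
  rw [hv] at ha h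
  refine ⟨ε, hε0, v, a, ha, ?_⟩
  rw [smul_add, ← add_assoc, h, sub_add_cancel]

/-- The graph of `A + D` is sequentially closed for the weak topology on the points and the norm
topology on the values, here at the value `0`. -/
theorem MaximallyMonotone.zero_mem_of_weak_limit [CompleteSpace H] {A : H → Set H}
    (hA : MaximallyMonotone A) {D : H → H} {K : NNReal} (hD : LipschitzWith K D)
    (hDm : MonotoneOp D) {ι : Type*} {l : Filter ι} [l.NeBot] {u y : ι → H} {y₀ : H} {R : ℝ}
    (hmem : ∀ n, ∃ a ∈ A (y n), a + D (y n) = u n) (hu : Tendsto u l (𝓝 0))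
    (hbdd : ∀ n, ‖y n‖ ≤ R) (hy : ∀ h, Tendsto (fun n => ⟪y n, h⟫) l (𝓝 ⟪y₀, h⟫)) :
    ∃ a ∈ A y₀, a + D y₀ = 0 := by
  -- Test point adapted to y₀: since y₀ - v = εb with b ∈ (A + D)v, the limit of the monotonicity
  -- inequalities reads -ε‖b‖² ≥ 0. Thus b = 0 and v = y₀, without showing that A + D is maximal.
  obtain ⟨ε, hε, v, a, ha, hv⟩ := hA.exists_forward_backward_eq hD y₀
  set b := a + D v with hb
  have h1 : ∀ n, 0 ≤ ⟪u n - b, y n - v⟫ := by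
    intro n
    obtain ⟨a', ha', h'⟩ := hmem n
    have e : u n - b = (a' - a) + (D (y n) - D v) := by rw [← h', hb]; abel
    rw [e, inner_add_left]
    exact add_nonneg (hA.monotone ha' ha) (hDm _ _)
  have h2 : Tendsto (fun n => ⟪u n, y n - v⟫) l (𝓝 0) := by
    refine squeeze_zero_norm (a := fun n => ‖u n‖ * (R + ‖v‖)) (fun n => ?_) ?_
    · refine (norm_inner_le_norm _ _).trans ?_
      gcongr
      exact (norm_sub_le _ _).trans (by gcongr; exact hbdd n)
    · simpa using hu.norm.mul_const (R + ‖v‖)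
  have h3 : Tendsto (fun n => ⟪u n - b, y n - v⟫) l (𝓝 (0 - (⟪y₀, b⟫ - ⟪b, v⟫))) := by
    refine (h2.sub ((hy b).sub_const ⟪b, v⟫)).congr fun n => ?_
    rw [inner_sub_left, inner_sub_right b, real_inner_comm (y n) b]
  have h4 : 0 ≤ 0 - (⟪y₀, b⟫ - ⟪b, v⟫) := ge_of_tendsto' h3 h1
  have hyv : y₀ = v + ε • b := hv.symm
  have h5 : ⟪y₀, b⟫ - ⟪b, v⟫ = ε * ‖b‖ ^ 2 := by
    rw [hyv, inner_add_left, real_inner_smul_left, real_inner_self_eq_norm_sq, real_inner_comm]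
    ring
  have h6 : ‖b‖ ^ 2 ≤ 0 := by
    rw [h5] at h4
    by_contra! h
    nlinarith
  have hb0 : b = 0 := norm_eq_zero.1 (by nlinarith [norm_nonneg b])
  rw [hb0, smul_zero, add_zero] at hyv
  subst hyv
  exact ⟨a, ha, hb0⟩

end Minty

/-! ### Weak cluster points, Opial's lemma and the weak topology -/

section WeakConvergence

theorem exists_norm_le_of_tendsto_norm_sub {H : Type*} [NormedAddCommGroup H] {x : ℕ → H} {z : H}
    (h : ∃ ℓ, Tendsto (fun k => ‖x k - z‖) atTop (𝓝 ℓ)) : ∃ R, ∀ k, ‖x k‖ ≤ R := by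
  obtain ⟨ℓ, hℓ⟩ := h
  obtain ⟨M, hM⟩ := hℓ.bddAbove_range
  refine ⟨M + ‖z‖, fun k => ?_⟩
  have h1 : ‖x k - z‖ ≤ M := hM ⟨k, rfl⟩
  have h2 := norm_add_le (x k - z) z
  rw [sub_add_cancel] at h2
  linarith

/-- Convergence of the distances to all points of `Z` may be tested on a dense subset of `Z`. -/
theorem exists_tendsto_norm_sub_of_subset_closure {H : Type*} [NormedAddCommGroup H]
    {D : Set H} {x : ℕ → H}
    (hconv : ∀ z ∈ D, ∃ ℓ, Tendsto (fun k => ‖x k - z‖) atTop (𝓝 ℓ)) {z : H}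
    (hz : z ∈ closure D) : ∃ ℓ, Tendsto (fun k => ‖x k - z‖) atTop (𝓝 ℓ) := by
  refine cauchySeq_tendsto_of_complete (Metric.cauchySeq_iff'.2 fun ε hε => ?_)
  obtain ⟨d, hd, hdz⟩ := Metric.mem_closure_iff.1 hz (ε / 3) (by positivity)
  obtain ⟨ℓ, hℓ⟩ := hconv d hd
  obtain ⟨N, hN⟩ := Metric.cauchySeq_iff'.1 hℓ.cauchySeq (ε / 3) (by positivity)
  refine ⟨N, fun n hn => ?_⟩
  have hnear : ∀ k, |‖x k - z‖ - ‖x k - d‖| ≤ dist z d := fun k => by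
    refine (abs_norm_sub_norm_le _ _).trans (le_of_eq ?_)
    rw [sub_sub_sub_cancel_left, dist_comm, dist_eq_norm]
  have h1 := hN n hn
  have h2 := abs_le.1 (hnear n)
  have h3 := abs_le.1 (hnear N)
  rw [Real.dist_eq, abs_lt] at h1 ⊢
  constructor <;> linarith [h1.1, h1.2, h2.1, h2.2, h3.1, h3.2]

variable {H : Type*} [NormedAddCommGroup H] [InnerProductSpace ℝ H]

/-- A bounded family in a Hilbert space converges weakly along every ultrafilter. -/
theorem exists_weak_limit_ultrafilter [CompleteSpace H] {ι : Type*} (U : Ultrafilter ι)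
    {x : ι → H} {R : ℝ} (hR : ∀ n, ‖x n‖ ≤ R) :
    ∃ x₀, ∀ h, Tendsto (fun n => ⟪x n, h⟫) U (𝓝 ⟪x₀, h⟫) := by
  have hb : ∀ n h, |⟪x n, h⟫| ≤ R * ‖h‖ := fun n h =>
    (abs_real_inner_le_norm _ _).trans (mul_le_mul_of_nonneg_right (hR n) (norm_nonneg h))
  have hex : ∀ h, ∃ ℓ ∈ Set.Icc (-(R * ‖h‖)) (R * ‖h‖), Tendsto (fun n => ⟪x n, h⟫) U (𝓝 ℓ) :=
    fun h => isCompact_Icc.ultrafilter_le_nhds (U.map fun n => ⟪x n, h⟫)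
      (tendsto_principal.2 (Eventually.of_forall fun n => abs_le.1 (hb n h)))
  choose f hf hlim using hex
  -- The limits along the ultrafilter form a bounded linear functional, which Riesz representation
  -- turns into a vector.
  let F : H →ₗ[ℝ] ℝ :=
    { toFun := f
      map_add' := fun a b => tendsto_nhds_unique (hlim (a + b))
        (((hlim a).add (hlim b)).congr fun n => (inner_add_right _ _ _).symm)
      map_smul' := fun t a => tendsto_nhds_unique (hlim (t • a))
        (((hlim a).const_mul t).congr fun n => (real_inner_smul_right _ _ _).symm) }
  let G : H →L[ℝ] ℝ := F.mkContinuous R fun h => abs_le.2 (hf h)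
  refine ⟨(InnerProductSpace.toDual ℝ H).symm G, fun h => ?_⟩
  rw [InnerProductSpace.toDual_symm_apply]
  exact hlim h

/-- **Opial's lemma**: if the distances of the sequence to all points of `Z` converge and its weak
cluster points lie in `Z`, then it converges weakly to a point of `Z`. -/
theorem exists_weak_limit_of_opial [CompleteSpace H] {Z : Set H} (hZ : Z.Nonempty) {x : ℕ → H}
    (hconv : ∀ z ∈ Z, ∃ ℓ, Tendsto (fun k => ‖x k - z‖) atTop (𝓝 ℓ))
    (hcl : ∀ U : Ultrafilter ℕ, (U : Filter ℕ) ≤ atTop → ∀ x₀,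
      (∀ h, Tendsto (fun k => ⟪x k, h⟫) U (𝓝 ⟪x₀, h⟫)) → x₀ ∈ Z) :
    ∃ x₀ ∈ Z, ∀ h, Tendsto (fun k => ⟪x k, h⟫) atTop (𝓝 ⟪x₀, h⟫) := by
  obtain ⟨R, hR⟩ := exists_norm_le_of_tendsto_norm_sub (hconv _ hZ.some_mem)
  have huniq : ∀ U V : Ultrafilter ℕ, (U : Filter ℕ) ≤ atTop → (V : Filter ℕ) ≤ atTop →
      ∀ a b, (∀ h, Tendsto (fun k => ⟪x k, h⟫) U (𝓝 ⟪a, h⟫)) →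
        (∀ h, Tendsto (fun k => ⟪x k, h⟫) V (𝓝 ⟪b, h⟫)) → a = b := by
    intro U V hU hV a b ha hb
    obtain ⟨ℓa, hℓa⟩ := hconv a (hcl U hU a ha)
    obtain ⟨ℓb, hℓb⟩ := hconv b (hcl V hV b hb)
    -- The term ‖x k‖² cancels in ‖x k - b‖² - ‖x k - a‖², so this inner product converges along the
    -- whole sequence and has the same limit along U and V.
    have hd : Tendsto (fun k => ⟪x k, a - b⟫) atTop
        (𝓝 ((ℓb ^ 2 - ℓa ^ 2 + ‖a‖ ^ 2 - ‖b‖ ^ 2) / 2)) := by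
      refine (((((hℓb.pow 2).sub (hℓa.pow 2)).add_const (‖a‖ ^ 2)).sub_const
        (‖b‖ ^ 2)).div_const 2).congr fun k => ?_
      rw [norm_sub_sq_real, norm_sub_sq_real, inner_sub_right]
      ring
    have h1 := tendsto_nhds_unique (hd.mono_left hU) (ha (a - b))
    have h2 := tendsto_nhds_unique (hd.mono_left hV) (hb (a - b))
    have h3 : ⟪a - b, a - b⟫ = 0 := by
      rw [inner_sub_left, ← h1, ← h2, sub_self]
    exact sub_eq_zero.1 (inner_self_eq_zero.1 h3)
  obtain ⟨x₀, hx₀⟩ := exists_weak_limit_ultrafilter (Ultrafilter.of (atTop : Filter ℕ)) hR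
  have hU₀ : (Ultrafilter.of (atTop : Filter ℕ) : Filter ℕ) ≤ atTop := Ultrafilter.of_le _
  refine ⟨x₀, hcl _ hU₀ x₀ hx₀, fun h => (tendsto_iff_ultrafilter _ _ _).2 fun U hU => ?_⟩
  obtain ⟨x₁, hx₁⟩ := exists_weak_limit_ultrafilter U hR
  rw [huniq _ U hU₀ hU x₀ x₁ hx₀ hx₁]
  exact hx₁ h

theorem tendsto_toWeakSpace_iff [CompleteSpace H] {ι : Type*} {l : Filter ι} {x : ι → H} {x₀ : H} :
    Tendsto (fun k => toWeakSpace ℝ H (x k)) l (𝓝 (toWeakSpace ℝ H x₀)) ↔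
      ∀ h, Tendsto (fun k => ⟪x k, h⟫) l (𝓝 ⟪x₀, h⟫) := by
  have hinj : Function.Injective (topDualPairing ℝ H).flip := by
    intro a b hab
    refine ext_inner_left ℝ fun h => ?_
    exact LinearMap.congr_fun hab (InnerProductSpace.toDual ℝ H h)
  refine (WeakBilin.tendsto_iff_forall_eval_tendsto _ hinj).trans ⟨fun h y => ?_, fun h y => ?_⟩
  · simp_rw [real_inner_comm y]
    exact h (InnerProductSpace.toDual ℝ H y)
  · have := h ((InnerProductSpace.toDual ℝ H).symm y)
    simp_rw [real_inner_comm ((InnerProductSpace.toDual ℝ H).symm y),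
      InnerProductSpace.toDual_symm_apply] at this
    exact this

end WeakConvergence

/-! ### Deterministic estimate for one step -/

section OneStep

variable {H : Type*} [NormedAddCommGroup H] [InnerProductSpace ℝ H]

theorem Cocoercive.monotone {β : ℝ} {C : H → H} (hC : Cocoercive β C) : MonotoneOp C :=
  fun x y => (mul_nonneg hC.1.le (sq_nonneg _)).trans (hC.2 x y)

theorem Cocoercive.lipschitzWith {β : ℝ} {C : H → H} (hC : Cocoercive β C) :
    LipschitzWith (β⁻¹).toNNReal C := by
  refine LipschitzWith.of_dist_le_mul fun x y => ?_
  have h := (hC.2 x y).trans (real_inner_le_norm _ _)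
  rw [dist_eq_norm, dist_eq_norm, Real.coe_toNNReal _ (inv_pos.2 hC.1).le, inv_mul_eq_div,
    le_div_iff₀ hC.1]
  rcases (norm_nonneg (C x - C y)).eq_or_lt with h0 | h0
  · rw [← h0, zero_mul]
    exact norm_nonneg _
  · refine le_of_mul_le_mul_left ?_ h0
    linarith

/-- The bound on γ is the positive root of γ²L² + γ/(2β) = 1 - λ, rationalized so that it also
covers L = 0. -/
theorem step_size_slack_pos {β L lam γ : ℝ} (hβ : 0 < β) (hlam : lam < 1) (hγ : 0 < γ)
    (h : γ < 4 * β * (1 - lam) / (1 + Real.sqrt (1 + 16 * β ^ 2 * L ^ 2 * (1 - lam)))) :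
    0 < 1 - lam - γ ^ 2 * L ^ 2 - γ / (2 * β) := by
  have h1 : 0 < 1 - lam := sub_pos.2 hlam
  set s := Real.sqrt (1 + 16 * β ^ 2 * L ^ 2 * (1 - lam)) with hs
  have hs0 : 0 ≤ s := Real.sqrt_nonneg _
  have hs2 : s ^ 2 = 1 + 16 * β ^ 2 * L ^ 2 * (1 - lam) := Real.sq_sqrt (by positivity)
  rw [lt_div_iff₀ (by positivity)] at h
  have h2 : γ * s < 4 * β * (1 - lam) - γ := by linarith
  have h3 : (γ * s) ^ 2 < (4 * β * (1 - lam) - γ) ^ 2 :=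
    pow_lt_pow_left₀ h2 (by positivity) two_ne_zero
  rw [mul_pow, hs2] at h3
  have h4 : 0 < 16 * β ^ 2 * (1 - lam) * (1 - lam - γ ^ 2 * L ^ 2 - γ / (2 * β)) := by
    have e : 16 * β ^ 2 * (1 - lam) * (1 - lam - γ ^ 2 * L ^ 2 - γ / (2 * β))
        = 16 * β ^ 2 * (1 - lam) ^ 2 - 16 * β ^ 2 * (1 - lam) * γ ^ 2 * L ^ 2
          - 8 * β * (1 - lam) * γ := by
      field_simp
      ring
    rw [e]
    nlinarith
  exact pos_of_mul_pos_right h4 (by positivity)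

/-- The deterministic part of the decrease of the Lyapunov function. -/
theorem norm_sq_resolvent_step_le {A : H → Set H} {B C : H → H} {β lam γ L : ℝ}
    (hA : MaximallyMonotone A) (hB : MonotoneOp B) (hC : Cocoercive β C) (hlam : 0 ≤ lam)
    (hγ : 0 < γ) {x w y z : H}
    (hy : y ∈ resolventOp γ A ((lam • x + (1 - lam) • w) - γ • (B w + C w)))
    (hz : z ∈ solutionSet A B C) :
    ‖y - z‖ ^ 2 + 2 * γ * ⟪B w - B y, y - z⟫ + γ ^ 2 * (L ^ 2 * ‖w - y‖ ^ 2)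
      ≤ lam * ‖x - z‖ ^ 2 + (1 - lam) * ‖w - z‖ ^ 2
        - (1 - lam - γ ^ 2 * L ^ 2 - γ / (2 * β)) * ‖w - y‖ ^ 2 := by
  obtain ⟨a, ha, hya⟩ := hy
  obtain ⟨b, hb, hbz⟩ := hz
  have hβ := hC.1
  have hmono := mul_nonneg hγ.le (hA.monotone ha hb)
  have hBm := mul_nonneg hγ.le (hB y z)
  have hCc := hC.2 w z
  have e1 : γ • (a - b) = lam • (x - y) + (1 - lam) • (w - y) - γ • (B w - B y) - γ • (B y - B z)
      - γ • (C w - C z) := by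
    have ha' : γ • a = (lam • x + (1 - lam) • w) - γ • (B w + C w) - y := by
      rw [← hya]; abel
    have hb' : b = -(B z + C z) := by
      rw [eq_neg_iff_add_eq_zero, ← add_assoc, hbz]
    rw [smul_sub, ha', hb']
    module
  rw [← real_inner_smul_left, e1] at hmono
  have e2 : x - z = (x - y) + (y - z) := by abel
  have e3 : w - z = (w - y) + (y - z) := by abel
  rw [e3, inner_add_right] at hCc
  rw [e2, e3, norm_add_sq_real, norm_add_sq_real]
  rw [inner_sub_left, inner_sub_left, inner_sub_left, inner_add_left] at hmono
  simp only [real_inner_smul_left] at hmono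
  -- Young's inequality, weighted so that β‖C w - C z‖² is exactly what cocoercivity supplies.
  have h4 : ⟪C w - C z, w - y⟫ ≤ β * ‖C w - C z‖ ^ 2 + ‖w - y‖ ^ 2 / (4 * β) := by
    refine (real_inner_le_norm _ _).trans ?_
    have : 0 ≤ (2 * β * ‖C w - C z‖ - ‖w - y‖) ^ 2 / (4 * β) := by positivity
    have e : (2 * β * ‖C w - C z‖ - ‖w - y‖) ^ 2 / (4 * β)
        = β * ‖C w - C z‖ ^ 2 + ‖w - y‖ ^ 2 / (4 * β) - ‖C w - C z‖ * ‖w - y‖ := by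
      field_simp
      ring
    linarith
  have h5 : -(γ * ⟪C w - C z, y - z⟫) ≤ γ * (‖w - y‖ ^ 2 / (4 * β)) := by
    rw [← mul_neg]
    exact mul_le_mul_of_nonneg_left (by linarith) hγ.le
  have h6 : γ / (2 * β) * ‖w - y‖ ^ 2 = 2 * (γ * (‖w - y‖ ^ 2 / (4 * β))) := by
    field_simp
    ring
  have h7 : 0 ≤ lam * ‖x - y‖ ^ 2 := by positivity
  linarith

end OneStep

/-! ### Mean estimates for the stochastic oracle -/

section Oracle

variable {H : Type*} [NormedAddCommGroup H] [InnerProductSpace ℝ H] [MeasurableSpace H]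
  {I : Type*} [MeasurableSpace I]

/-- Jensen's inequality: B inherits the constant L from its oracle, so its continuity need not be
assumed. -/
theorem IsOracle.lipschitzWith [CompleteSpace H] {Q : Measure I} [IsProbabilityMeasure Q]
    {Bo : I → H → H} {B : H → H} {L : ℝ} (hL : 0 ≤ L) (h : IsOracle Q Bo B L) :
    LipschitzWith L.toNNReal B := by
  refine LipschitzWith.of_dist_le_mul fun u v => ?_
  rw [Real.coe_toNNReal _ hL, dist_eq_norm, dist_eq_norm, ← h.unbiased, ← h.unbiased,
    ← integral_sub (h.integrable u) (h.integrable v)]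
  have hi : Integrable (fun i => ‖Bo i u - Bo i v‖) Q :=
    ((h.integrable u).sub (h.integrable v)).norm
  refine (norm_integral_le_integral_norm _).trans ?_
  set t := ∫ i, ‖Bo i u - Bo i v‖ ∂Q with ht
  refine le_of_sq_le_sq ?_ (by positivity)
  rw [mul_pow]
  refine le_trans ?_ (h.lipschitz_in_mean u v)
  -- Nonnegativity of the variance of ‖Bo i u - Bo i v‖, whose mean is t.
  have h0 : 0 ≤ ∫ i, (‖Bo i u - Bo i v‖ ^ 2 - 2 * t * ‖Bo i u - Bo i v‖ + t ^ 2) ∂Q :=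
    integral_nonneg fun i => by
      have := sq_nonneg (‖Bo i u - Bo i v‖ - t)
      simp only [Pi.zero_apply]
      linarith
  have hi' : Integrable (fun i => ‖Bo i u - Bo i v‖ ^ 2 - 2 * t * ‖Bo i u - Bo i v‖) Q :=
    (h.integrable_sq u v).sub (hi.const_mul _)
  rw [integral_add hi' (integrable_const _),
    integral_sub (h.integrable_sq u v) (hi.const_mul _), integral_const_mul, ← ht] at h0
  simp only [integral_const, probReal_univ, one_smul] at h0
  linarith

/-- The mean of the squared distance to `z` after a correction step. -/
theorem IsOracle.integral_norm_sq_correction_le [CompleteSpace H] {Q : Measure I}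
    [IsProbabilityMeasure Q] {Bo : I → H → H} {B : H → H} {L : ℝ} (h : IsOracle Q Bo B L)
    (γ : ℝ) (w y z : H) :
    Integrable (fun i => ‖y + γ • (Bo i w - Bo i y) - z‖ ^ 2) Q ∧
      ∫ i, ‖y + γ • (Bo i w - Bo i y) - z‖ ^ 2 ∂Q
        ≤ ‖y - z‖ ^ 2 + 2 * γ * ⟪B w - B y, y - z⟫ + γ ^ 2 * (L ^ 2 * ‖w - y‖ ^ 2) := by
  have e : (fun i => ‖y + γ • (Bo i w - Bo i y) - z‖ ^ 2) = fun i =>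
      ‖y - z‖ ^ 2 + 2 * γ * ⟪y - z, Bo i w - Bo i y⟫ + γ ^ 2 * ‖Bo i w - Bo i y‖ ^ 2 := by
    funext i
    rw [show y + γ • (Bo i w - Bo i y) - z = (y - z) + γ • (Bo i w - Bo i y) by abel,
      norm_add_sq_real, real_inner_smul_right, norm_smul, mul_pow, Real.norm_eq_abs, sq_abs]
    ring
  have hi : Integrable (fun i => Bo i w - Bo i y) Q := (h.integrable w).sub (h.integrable y)
  have h1 : Integrable (fun _ : I => ‖y - z‖ ^ 2) Q := integrable_const _
  have h2 : Integrable (fun i => 2 * γ * ⟪y - z, Bo i w - Bo i y⟫) Q :=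
    (hi.const_inner (y - z)).const_mul _
  have h3 : Integrable (fun i => γ ^ 2 * ‖Bo i w - Bo i y‖ ^ 2) Q :=
    (h.integrable_sq w y).const_mul _
  have h12 : Integrable (fun i => ‖y - z‖ ^ 2 + 2 * γ * ⟪y - z, Bo i w - Bo i y⟫) Q := h1.add h2
  rw [e]
  refine ⟨h12.add h3, ?_⟩
  rw [integral_add h12 h3, integral_add h1 h2, integral_const_mul, integral_const_mul,
    integral_inner hi, integral_sub (h.integrable w) (h.integrable y), h.unbiased, h.unbiased,
    real_inner_comm (B w - B y)]
  simp only [integral_const, probReal_univ, one_smul]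
  gcongr
  exact h.lipschitz_in_mean w y

end Oracle

/-! ### Integrating out an independent variable -/

section Freezing

variable {Ω E F : Type*} {m : MeasurableSpace Ω} [mΩ : MeasurableSpace Ω] [MeasurableSpace E]
  [MeasurableSpace F]

/-- Freezing of the variable that is measurable with respect to `m`, when the other one is
independent of `m`. -/
theorem setLIntegral_comp_prodMk_of_indep {P : Measure Ω} [IsProbabilityMeasure P]
    (hm : m ≤ mΩ) {X : Ω → E} {Y : Ω → F} (hX : Measurable[m] X)
    (hY : Measurable Y) (hind : Indep m (MeasurableSpace.comap Y inferInstance) P)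
    {ψ : E × F → ENNReal} (hψ : Measurable ψ) {S : Set Ω} (hS : MeasurableSet[m] S) :
    ∫⁻ ω in S, ψ (X ω, Y ω) ∂P = ∫⁻ ω in S, ∫⁻ y, ψ (X ω, y) ∂(P.map Y) ∂P := by
  have hX' : Measurable X := hX.mono hm le_rfl
  have : IsProbabilityMeasure (P.map Y) := Measure.isProbabilityMeasure_map hY.aemeasurable
  -- As S belongs to `m`, independence keeps the joint law a product after restriction to S.
  have hprod : ((P.restrict S).map X).prod (P.map Y)
      = (P.restrict S).map (fun ω => (X ω, Y ω)) := by
    refine Measure.prod_eq fun s t hs ht => ?_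
    rw [Measure.map_apply (hX'.prodMk hY) (hs.prod ht), Measure.map_apply hX' hs,
      Measure.map_apply hY ht, Measure.restrict_apply ((hX'.prodMk hY) (hs.prod ht)),
      Measure.restrict_apply (hX' hs), Set.mk_preimage_prod]
    have h1 : MeasurableSet[m] (X ⁻¹' s ∩ S) := (hX hs).inter hS
    have h2 : MeasurableSet[MeasurableSpace.comap Y inferInstance] (Y ⁻¹' t) := ⟨t, ht, rfl⟩
    rw [← (Indep_iff _ _ _).1 hind _ _ h1 h2]
    congr 1
    ext ω
    simp only [Set.mem_inter_iff]
    tauto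
  rw [← lintegral_map (f := ψ) hψ (hX'.prodMk hY), ← hprod, lintegral_prod _ hψ.aemeasurable,
    lintegral_map hψ.lintegral_prod_right' hX']

end Freezing

/-! ### Nonnegative supermartingales and summable mean squares -/

section Supermartingale

variable {Ω : Type*} [mΩ : MeasurableSpace Ω] {P : Measure Ω} [IsProbabilityMeasure P]

/-- A nonnegative adapted process that decreases in mean on all sets of the past is a
supermartingale. -/
theorem supermartingale_of_setLIntegral_le {𝒢 : Filtration ℕ mΩ} {V : ℕ → Ω → ℝ}
    (hV : ∀ k ω, 0 ≤ V k ω) (hadp : StronglyAdapted 𝒢 V) (hint : ∀ k, Integrable (V k) P)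
    (hle : ∀ k S, MeasurableSet[𝒢 k] S →
      ∫⁻ ω in S, ENNReal.ofReal (V (k + 1) ω) ∂P ≤ ∫⁻ ω in S, ENNReal.ofReal (V k ω) ∂P) :
    Supermartingale V 𝒢 P := by
  refine supermartingale_of_setIntegral_succ_le hadp hint fun k S hS => ?_
  rw [integral_eq_lintegral_of_nonneg_ae (ae_of_all _ (hV _)) (hint _).1.restrict,
    integral_eq_lintegral_of_nonneg_ae (ae_of_all _ (hV _)) (hint _).1.restrict]
  refine ENNReal.toReal_mono (ne_of_lt ?_) (hle k S hS)
  exact (setLIntegral_le_lintegral _ _).trans_lt (hint k).lintegral_lt_top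

/-- Doob's convergence theorem for the submartingale -V, bounded in L¹ by the mean of V 0. -/
theorem supermartingale_exists_ae_tendsto {𝒢 : Filtration ℕ mΩ} {V : ℕ → Ω → ℝ}
    (hV : ∀ k ω, 0 ≤ V k ω) (hsup : Supermartingale V 𝒢 P) :
    ∀ᵐ ω ∂P, ∃ ℓ, Tendsto (fun k => V k ω) atTop (𝓝 ℓ) := by
  have hbdd : ∀ k, eLpNorm ((-V) k) 1 P ≤ (Real.toNNReal (∫ ω, V 0 ω ∂P) : ENNReal) := by
    intro k
    rw [Pi.neg_apply, eLpNorm_neg, eLpNorm_one_eq_lintegral_enorm]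
    have h1 : ∀ ω, ‖V k ω‖ₑ = ENNReal.ofReal (V k ω) := fun ω =>
      Real.enorm_of_nonneg (hV k ω)
    simp_rw [h1]
    rw [← ofReal_integral_eq_lintegral_ofReal (hsup.integrable k) (ae_of_all _ (hV k))]
    refine ENNReal.ofReal_le_ofReal ?_
    have := hsup.setIntegral_le (Nat.zero_le k) (MeasurableSet.univ)
    simpa using this
  filter_upwards [hsup.neg.exists_ae_tendsto_of_bdd hbdd] with ω ⟨ℓ, hℓ⟩
  exact ⟨-ℓ, by simpa using hℓ.neg⟩

omit [IsProbabilityMeasure P] in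
-- By Tonelli the sum of the squares has finite mean, so it is almost surely finite and its terms
-- vanish.
theorem ae_tendsto_zero_of_tsum_lintegral_ne_top {g : ℕ → Ω → ℝ} (hg : ∀ k, Measurable (g k))
    (hg0 : ∀ k ω, 0 ≤ g k ω) (h : ∑' k, ∫⁻ ω, ENNReal.ofReal (g k ω ^ 2) ∂P ≠ ⊤) :
    ∀ᵐ ω ∂P, Tendsto (fun k => g k ω) atTop (𝓝 0) := by
  have hm : ∀ k, Measurable fun ω => ENNReal.ofReal (g k ω ^ 2) := fun k =>
    ((hg k).pow_const 2).ennreal_ofReal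
  rw [← lintegral_tsum fun k => (hm k).aemeasurable] at h
  filter_upwards [ae_lt_top (Measurable.tsum hm) h] with ω hω
  have h1 := ENNReal.tendsto_atTop_zero_of_tsum_ne_top hω.ne
  have h2 := (ENNReal.tendsto_toReal ENNReal.zero_ne_top).comp h1
  have h3 : Tendsto (fun k => g k ω ^ 2) atTop (𝓝 0) := by
    refine (h2.congr fun k => ?_).trans (by simp)
    exact ENNReal.toReal_ofReal (sq_nonneg _)
  have h4 := h3.sqrt
  simp only [Real.sqrt_sq (hg0 _ _), Real.sqrt_zero] at h4
  exact h4

theorem tsum_le_of_add_le {a r : ℕ → ENNReal} (h : ∀ k, a (k + 1) + r k ≤ a k) :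
    ∑' k, r k ≤ a 0 := by
  have hn : ∀ n, a n + ∑ k ∈ Finset.range n, r k ≤ a 0 := by
    intro n
    induction n with
    | zero => simp
    | succ n ih =>
      rw [Finset.sum_range_succ, add_comm (∑ k ∈ Finset.range n, r k), ← add_assoc]
      exact (add_le_add_left (h n) _).trans ih
  exact ENNReal.tsum_le_of_sum_range_le fun n => le_add_self.trans (hn n)

end Supermartingale

/-! ### Measurability of weak limits -/

section Pettis

variable {H : Type*} [NormedAddCommGroup H] [InnerProductSpace ℝ H]
  [TopologicalSpace.SeparableSpace H] [MeasurableSpace H] [BorelSpace H]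
  {Ω : Type*} [MeasurableSpace Ω]

/-- A map into a separable Hilbert space with measurable inner products is measurable. -/
theorem measurable_of_measurable_inner {f : Ω → H} (hf : ∀ h, Measurable fun ω => ⟪f ω, h⟫) :
    Measurable f := by
  have hball : ∀ a r, MeasurableSet (f ⁻¹' Metric.closedBall a r) := by
    intro a r
    rcases lt_or_ge r 0 with hr | hr
    · rw [Metric.closedBall_eq_empty.2 hr]
      exact MeasurableSet.empty
    have e : f ⁻¹' Metric.closedBall a r = ⋂ n, {ω |
        ⟪f ω, TopologicalSpace.denseSeq H n⟫ - ⟪a, TopologicalSpace.denseSeq H n⟫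
          ≤ r * ‖TopologicalSpace.denseSeq H n‖} := by
      ext ω
      simp only [Set.mem_preimage, Metric.mem_closedBall, dist_eq_norm, Set.mem_iInter,
        Set.mem_ofPred_eq, ← inner_sub_left]
      constructor
      · intro h n
        exact (real_inner_le_norm _ _).trans (by gcongr)
      · intro h
        have hall : ∀ v, ⟪f ω - a, v⟫ ≤ r * ‖v‖ := by
          have hcl : IsClosed {v | ⟪f ω - a, v⟫ ≤ r * ‖v‖} :=
            isClosed_le (by fun_prop) (by fun_prop)
          intro v
          have := (TopologicalSpace.denseRange_denseSeq H).closure_range ▸ Set.mem_univ v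
          exact hcl.closure_subset_iff.2 (Set.range_subset_iff.2 h) this
        have h1 := hall (f ω - a)
        rw [real_inner_self_eq_norm_sq] at h1
        rcases (norm_nonneg (f ω - a)).eq_or_lt with h0 | h0
        · rw [← h0]; exact hr
        · refine le_of_mul_le_mul_right ?_ h0
          linarith
    rw [e]
    exact MeasurableSet.iInter fun n => measurableSet_le ((hf _).sub_const _) measurable_const
  refine measurable_of_isOpen fun U hU => ?_
  have e : f ⁻¹' U = ⋃ (n : ℕ) (q : ℚ)
      (_ : Metric.closedBall (TopologicalSpace.denseSeq H n) q ⊆ U),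
      f ⁻¹' Metric.closedBall (TopologicalSpace.denseSeq H n) q := by
    ext ω
    simp only [Set.mem_preimage, Set.mem_iUnion, exists_prop]
    constructor
    · intro h
      obtain ⟨ε, hε, hU'⟩ := Metric.isOpen_iff.1 hU _ h
      obtain ⟨n, hn⟩ := (TopologicalSpace.denseRange_denseSeq H).exists_dist_lt (f ω)
        (show 0 < ε / 3 by positivity)
      obtain ⟨q, hq1, hq2⟩ := exists_rat_btwn (show ε / 3 < ε / 2 by linarith)
      refine ⟨n, q, fun v hv => hU' ?_, Metric.mem_closedBall.2 (hn.le.trans hq1.le)⟩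
      rw [Metric.mem_closedBall] at hv
      rw [Metric.mem_ball]
      rw [dist_comm] at hn
      linarith [dist_triangle v (TopologicalSpace.denseSeq H n) (f ω)]
    · rintro ⟨n, q, hsub, h⟩
      exact hsub h
  rw [e]
  exact MeasurableSet.iUnion fun n => MeasurableSet.iUnion fun q => MeasurableSet.iUnion fun _ =>
    hball _ _

/-- Almost sure weak limits can be chosen measurable. -/
theorem exists_measurable_weak_limit {P : Measure Ω} {Z : Set H} (hZ : Z.Nonempty)
    {x : ℕ → Ω → H} (hx : ∀ k, Measurable (x k))
    (h : ∀ᵐ ω ∂P, ∃ x₀ ∈ Z, ∀ v, Tendsto (fun k => ⟪x k ω, v⟫) atTop (𝓝 ⟪x₀, v⟫)) :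
    ∃ xlim : Ω → H, Measurable xlim ∧ (∀ ω, xlim ω ∈ Z) ∧
      ∀ᵐ ω ∂P, ∀ v, Tendsto (fun k => ⟪x k ω, v⟫) atTop (𝓝 ⟪xlim ω, v⟫) := by
  classical
  obtain ⟨z₀, hz₀⟩ := hZ
  -- On a measurable null set N containing the bad paths the limit is replaced by z₀. The inner
  -- products are then pointwise limits everywhere.
  obtain ⟨N, hN, hNm, hN0⟩ := exists_measurable_superset_of_null (ae_iff.1 h)
  have hex : ∀ ω, ∃ x₀ ∈ Z, (ω ∈ N → x₀ = z₀) ∧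
      (ω ∉ N → ∀ v, Tendsto (fun k => ⟪x k ω, v⟫) atTop (𝓝 ⟪x₀, v⟫)) := by
    intro ω
    by_cases hω : ω ∈ N
    · exact ⟨z₀, hz₀, fun _ => rfl, fun h => absurd hω h⟩
    · have : ω ∉ {ω | ¬ ∃ x₀ ∈ Z, ∀ v, Tendsto (fun k => ⟪x k ω, v⟫) atTop (𝓝 ⟪x₀, v⟫)} :=
        fun h' => hω (hN h')
      rw [Set.mem_ofPred_eq, not_not] at this
      obtain ⟨x₀, hx₀, hlim⟩ := this
      exact ⟨x₀, hx₀, fun h => absurd h hω, fun _ => hlim⟩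
  choose xlim hmem hin hout using hex
  refine ⟨xlim, measurable_of_measurable_inner fun v => ?_, hmem, ?_⟩
  · refine measurable_of_tendsto_metrizable
      (f := fun k ω => if ω ∈ N then ⟪z₀, v⟫ else ⟪x k ω, v⟫) (fun k => ?_) ?_
    · have : Continuous fun u : H => ⟪u, v⟫ := by fun_prop
      exact Measurable.ite hNm measurable_const (this.measurable.comp (hx k))
    · refine tendsto_pi_nhds.2 fun ω => ?_
      by_cases hω : ω ∈ N
      · simp only [hω, if_true, hin ω hω]
        exact tendsto_const_nhds
      · simp only [hω, if_false]
        exact hout ω hω v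
  · have : ∀ᵐ ω ∂P, ω ∉ N := measure_eq_zero_iff_ae_notMem.1 hN0
    filter_upwards [this] with ω hω
    exact hout ω hω

end Pettis

/-! ### The σ-algebras of the algorithm and the law of one draw -/

section Information

variable {I : Type*} [MeasurableSpace I] {Ω : Type*}

theorem history_mono (ξ : ℕ → Ω → I) {H : Type*} [MeasurableSpace H] (w : ℕ → Ω → H) :
    Monotone (history ξ w) := by
  intro k l hkl
  refine sup_le_sup ?_ ?_
  · exact biSup_mono fun j hj => Finset.mem_range.2 ((Finset.mem_range.1 hj).trans_le hkl)
  · exact biSup_mono fun j hj =>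
      Finset.mem_range.2 ((Finset.mem_range.1 hj).trans_le (Nat.succ_le_succ hkl))

theorem measurable_history_w (ξ : ℕ → Ω → I) {H : Type*} [MeasurableSpace H] (w : ℕ → Ω → H)
    {j k : ℕ} (hj : j ≤ k) :
    Measurable[history ξ w k] (w j) :=
  Measurable.of_comap_le <| le_sup_of_le_right <|
    le_biSup (fun j => MeasurableSpace.comap (w j) inferInstance)
      (Finset.mem_range.2 (Nat.lt_succ_of_le hj))

theorem measurable_history_index (ξ : ℕ → Ω → I) {H : Type*} [MeasurableSpace H] (w : ℕ → Ω → H)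
    {j k : ℕ} (hj : j < k) :
    Measurable[history ξ w k] (ξ j) :=
  Measurable.of_comap_le <| le_sup_of_le_left <|
    le_biSup (fun j => MeasurableSpace.comap (ξ j) inferInstance) (Finset.mem_range.2 hj)

/-- The σ-algebra generated by the indices and the coins drawn before step `k`. -/
abbrev past (ξ : ℕ → Ω → I) (c : ℕ → Ω → Bool) (k : ℕ) : MeasurableSpace Ω :=
  ⨆ j ∈ Set.Iio k, MeasurableSpace.comap (fun ω => (ξ j ω, c j ω)) inferInstance

theorem past_mono (ξ : ℕ → Ω → I) (c : ℕ → Ω → Bool) : Monotone (past ξ c) :=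
  fun _ _ hkl => biSup_mono fun _ hj => lt_of_lt_of_le hj hkl

theorem measurable_past (ξ : ℕ → Ω → I) (c : ℕ → Ω → Bool) {j k : ℕ} (hj : j < k) :
    Measurable[past ξ c k] (fun ω => (ξ j ω, c j ω)) :=
  Measurable.of_comap_le <|
    le_biSup (fun j => MeasurableSpace.comap (fun ω => (ξ j ω, c j ω)) inferInstance)
      (show j ∈ Set.Iio k from hj)

variable [mΩ : MeasurableSpace Ω] {P : Measure Ω} {Q : Measure I} {p : ℝ} {ξ : ℕ → Ω → I}
  {c : ℕ → Ω → Bool}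

theorem IsSampling.past_le (hs : IsSampling P Q p ξ c) (k : ℕ) : past ξ c k ≤ mΩ :=
  iSup₂_le fun j _ => ((hs.measurable_index j).prodMk (hs.measurable_coin j)).comap_le

theorem IsSampling.indep_past (hs : IsSampling P Q p ξ c) (k : ℕ) :
    Indep (past ξ c k) (MeasurableSpace.comap (fun ω => (ξ k ω, c k ω)) inferInstance) P := by
  have h := indep_iSup_of_disjoint (S := Set.Iio k) (T := {k})
    (fun j => ((hs.measurable_index j).prodMk (hs.measurable_coin j)).comap_le) hs.indep_pairs
    (by simp)
  simpa [past] using h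

theorem IsSampling.map_index_coin [IsProbabilityMeasure P] (hs : IsSampling P Q p ξ c) (k : ℕ) :
    P.map (fun ω => (ξ k ω, c k ω)) = Q.prod (P.map (c k)) := by
  rw [(hs.indep_index_coin k).map_prod_eq_prod_map_map (hs.measurable_index k).aemeasurable
    (hs.measurable_coin k).aemeasurable, hs.law_index]

theorem IsSampling.lintegral_coin [IsProbabilityMeasure P] (hs : IsSampling P Q p ξ c) (k : ℕ)
    (f : Bool → ENNReal) :
    ∫⁻ b, f b ∂(P.map (c k)) = f true * ENNReal.ofReal p + f false * ENNReal.ofReal (1 - p) := by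
  have hc := hs.measurable_coin k
  have : IsProbabilityMeasure (P.map (c k)) := Measure.isProbabilityMeasure_map hc.aemeasurable
  have ht : (P.map (c k)).real {true} = p := by
    rw [map_measureReal_apply hc (measurableSet_singleton _)]
    exact hs.law_coin k
  have hf : (P.map (c k)).real {false} = 1 - p := by
    rw [← ht, ← probReal_compl_eq_one_sub (measurableSet_singleton _)]
    congr 1
    ext b
    cases b <;> simp
  rw [lintegral_fintype, Fintype.sum_bool, ← ofReal_measureReal, ← ofReal_measureReal, ht, hf]

theorem lyapunov_nonneg {Ω H : Type*} [NormedAddCommGroup H] {lam p : ℝ} {x w : ℕ → Ω → H}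
    (hp : 0 < p) (hlam : 0 ≤ lam ∧ lam < 1) (k : ℕ) (z : H) (ω : Ω) :
    0 ≤ lyapunov lam p x w k z ω := by
  have hlam1 : 0 < 1 - lam := sub_pos.2 hlam.2
  have h0 := hlam.1
  unfold lyapunov
  positivity

end Information

/-! ### Measurability of the iterates -/

section Measurability

variable {H : Type*} [NormedAddCommGroup H] [InnerProductSpace ℝ H] [CompleteSpace H]
  [TopologicalSpace.SeparableSpace H] [MeasurableSpace H] [BorelSpace H]
  {I : Type*} {Ω : Type*}

omit [TopologicalSpace.SeparableSpace H] in
theorem MaximallyMonotone.measurable_of_mem_resolventOp {A : H → Set H}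
    (hA : MaximallyMonotone A) {γ : ℝ} (hγ : 0 < γ) [MeasurableSpace Ω] {f y : Ω → H}
    (hf : Measurable f) (hy : ∀ ω, y ω ∈ resolventOp γ A (f ω)) : Measurable y := by
  choose J hJ using fun z => hA.resolventOp_nonempty hγ z
  have hLip : LipschitzWith 1 J := LipschitzWith.of_dist_le_mul fun z z' => by
    rw [dist_eq_norm, dist_eq_norm, NNReal.coe_one, one_mul]
    exact hA.norm_sub_le_of_mem_resolventOp hγ (hJ z) (hJ z')
  have e : y = J ∘ f := by
    funext ω
    have := hA.norm_sub_le_of_mem_resolventOp hγ (hy ω) (hJ (f ω))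
    rw [sub_self, norm_zero] at this
    exact sub_eq_zero.1 (norm_le_zero_iff.1 this)
  rw [e]
  exact hLip.continuous.measurable.comp hf

variable {A : H → Set H} {B C : H → H} {Bo : I → H → H} {lam γ : ℝ} {x₀ : H}
  {ξ : ℕ → Ω → I} {c : ℕ → Ω → Bool} {x y w : ℕ → Ω → H}

theorem IsIterates.measurable_y {m : MeasurableSpace Ω}
    (hiter : IsIterates A B C Bo lam γ x₀ ξ c x y w) (hA : MaximallyMonotone A) (hγ : 0 < γ)
    (hB : Continuous B) (hC : Continuous C) {k : ℕ} (hx : Measurable (x k))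
    (hw : Measurable (w k)) : Measurable (y k) := by
  have := UniformSpace.secondCountable_of_separable H
  refine hA.measurable_of_mem_resolventOp hγ ?_ (hiter.step_y k)
  exact ((hx.const_smul lam).add (hw.const_smul (1 - lam))).sub
    (((hB.measurable.comp hw).add (hC.measurable.comp hw)).const_smul γ)

omit [CompleteSpace H] [TopologicalSpace.SeparableSpace H] [BorelSpace H] in
theorem IsIterates.measurable_w_succ [MeasurableSpace Ω]
    (hiter : IsIterates A B C Bo lam γ x₀ ξ c x y w) {k : ℕ} (hx : Measurable (x (k + 1)))
    (hw : Measurable (w k)) (hc : Measurable (c k)) : Measurable (w (k + 1)) := by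
  rw [show w (k + 1) = _ from funext (hiter.step_w k)]
  exact Measurable.ite (hc (measurableSet_singleton true)) hx hw

variable [MeasurableSpace I]

omit [CompleteSpace H] in
theorem IsIterates.measurable_x_succ [MeasurableSpace Ω]
    (hiter : IsIterates A B C Bo lam γ x₀ ξ c x y w)
    (hBo : Measurable (fun q : I × H => Bo q.1 q.2)) {k : ℕ} (hy : Measurable (y k))
    (hw : Measurable (w k)) (hξ : Measurable (ξ k)) : Measurable (x (k + 1)) := by
  have := UniformSpace.secondCountable_of_separable H
  rw [show x (k + 1) = _ from funext (hiter.step_x k)]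
  exact hy.add (((hBo.comp (hξ.prodMk hw)).sub (hBo.comp (hξ.prodMk hy))).const_smul γ)

/-- No coin is needed: x^{k+1} is a function of x^k, w^k and ξ_k, and the w^j themselves generate
part of the history. -/
theorem IsIterates.measurable_history_x
    (hiter : IsIterates A B C Bo lam γ x₀ ξ c x y w) (hA : MaximallyMonotone A) (hγ : 0 < γ)
    (hB : Continuous B) (hC : Continuous C)
    (hBo : Measurable (fun q : I × H => Bo q.1 q.2)) (k : ℕ) :
    Measurable[history ξ w k] (x k) := by
  induction k with
  | zero =>
    rw [show x 0 = fun _ => x₀ from funext hiter.init_x]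
    exact measurable_const
  | succ k ih =>
    let _ : MeasurableSpace Ω := history ξ w (k + 1)
    have hx : Measurable (x k) := ih.mono (history_mono ξ w k.le_succ) le_rfl
    have hw : Measurable (w k) := measurable_history_w ξ w k.le_succ
    exact hiter.measurable_x_succ hBo (hiter.measurable_y hA hγ hB hC hx hw) hw
      (measurable_history_index ξ w k.lt_succ_self)

theorem IsIterates.measurable_past_x_w
    (hiter : IsIterates A B C Bo lam γ x₀ ξ c x y w) (hA : MaximallyMonotone A) (hγ : 0 < γ)
    (hB : Continuous B) (hC : Continuous C)
    (hBo : Measurable (fun q : I × H => Bo q.1 q.2)) (k : ℕ) :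
    Measurable[past ξ c k] (x k) ∧ Measurable[past ξ c k] (w k) := by
  induction k with
  | zero =>
    rw [show x 0 = fun _ => x₀ from funext hiter.init_x,
      show w 0 = fun _ => x₀ from funext hiter.init_w]
    exact ⟨measurable_const, measurable_const⟩
  | succ k ih =>
    let _ : MeasurableSpace Ω := past ξ c (k + 1)
    have hx : Measurable (x k) := ih.1.mono (past_mono ξ c k.le_succ) le_rfl
    have hw : Measurable (w k) := ih.2.mono (past_mono ξ c k.le_succ) le_rfl
    have hp : Measurable fun ω => (ξ k ω, c k ω) := measurable_past ξ c k.lt_succ_self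
    have hx' := hiter.measurable_x_succ hBo (hiter.measurable_y hA hγ hB hC hx hw) hw hp.fst
    exact ⟨hx', hiter.measurable_w_succ hx' hw hp.snd⟩

/-- This inclusion makes the history at step k independent of the fresh pair (ξ_k, c_k). -/
theorem IsIterates.history_le_past
    (hiter : IsIterates A B C Bo lam γ x₀ ξ c x y w) (hA : MaximallyMonotone A) (hγ : 0 < γ)
    (hB : Continuous B) (hC : Continuous C)
    (hBo : Measurable (fun q : I × H => Bo q.1 q.2)) (k : ℕ) : history ξ w k ≤ past ξ c k := by
  refine sup_le (iSup₂_le fun j hj => Measurable.comap_le ?_) (iSup₂_le fun j hj =>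
    Measurable.comap_le ?_)
  · exact (measurable_past ξ c (Finset.mem_range.1 hj)).fst
  · exact (hiter.measurable_past_x_w hA hγ hB hC hBo j).2.mono
      (past_mono ξ c (Nat.lt_succ_iff.1 (Finset.mem_range.1 hj))) le_rfl

end Measurability

/-! ### Decrease of the Lyapunov function in mean -/

section Decrease

variable {H : Type*} [NormedAddCommGroup H] [InnerProductSpace ℝ H] [CompleteSpace H]
  [TopologicalSpace.SeparableSpace H] [MeasurableSpace H] [BorelSpace H]
  {I : Type*} [MeasurableSpace I] {Ω : Type*} [mΩ : MeasurableSpace Ω]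
  {P : Measure Ω} [IsProbabilityMeasure P] {Q : Measure I} [IsProbabilityMeasure Q]
  {A : H → Set H} {B C : H → H} {Bo : I → H → H} {L β lam p γ : ℝ} {x₀ : H}
  {ξ : ℕ → Ω → I} {c : ℕ → Ω → Bool} {x y w : ℕ → Ω → H}

/-- The mean over index and coin of the Lyapunov function after one step, where `d` is the squared
distance of the new point `x` and `e` that of the old reference point `w`. -/
theorem lintegral_step_le (hs : IsSampling P Q p ξ c) (hp : 0 < p ∧ p ≤ 1)
    (hlam : 0 ≤ lam ∧ lam < 1) {d : I → ℝ} (hd : Integrable d Q) (hdm : Measurable d)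
    (hd0 : ∀ i, 0 ≤ d i) {e : ℝ}
    (he : 0 ≤ e) (k : ℕ) :
    ∫⁻ q, ENNReal.ofReal (lam * d q.1 + (1 - lam) / p * (if q.2 = true then d q.1 else e))
        ∂(P.map fun ω => (ξ k ω, c k ω))
      = ENNReal.ofReal (∫ i, d i ∂Q + (1 - lam) * (1 - p) / p * e) := by
  have hlam1 : 0 < 1 - lam := sub_pos.2 hlam.2
  have hp0 := hp.1
  have hp1 : 0 ≤ 1 - p := sub_nonneg.2 hp.2
  have hm : Measurable fun q : I × Bool =>
      ENNReal.ofReal (lam * d q.1 + (1 - lam) / p * (if q.2 = true then d q.1 else e)) := by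
    refine Measurable.ennreal_ofReal ?_
    refine ((hdm.comp measurable_fst).const_mul _).add (Measurable.const_mul ?_ _)
    exact Measurable.ite (measurable_snd (measurableSet_singleton true)) (hdm.comp measurable_fst)
      measurable_const
  have : IsProbabilityMeasure (P.map (c k)) :=
    Measure.isProbabilityMeasure_map (hs.measurable_coin k).aemeasurable
  rw [hs.map_index_coin, lintegral_prod _ hm.aemeasurable]
  simp only [hs.lintegral_coin, if_true, Bool.false_eq_true, if_false]
  -- The new distance gets total weight λ + p·(1-λ)/p = 1, which explains the factor 1/p in Φ.
  have hpt : ∀ i, ENNReal.ofReal (lam * d i + (1 - lam) / p * d i) * ENNReal.ofReal p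
      + ENNReal.ofReal (lam * d i + (1 - lam) / p * e) * ENNReal.ofReal (1 - p)
      = ENNReal.ofReal (d i + (1 - lam) * (1 - p) / p * e) := by
    intro i
    have := hd0 i
    have h0 := hlam.1
    rw [← ENNReal.ofReal_mul (by positivity), ← ENNReal.ofReal_mul (by positivity),
      ← ENNReal.ofReal_add (by positivity) (by positivity)]
    congr 1
    field_simp
    ring
  simp only [hpt]
  have hde : Integrable (fun i => d i + (1 - lam) * (1 - p) / p * e) Q :=
    hd.add (integrable_const _)
  rw [← ofReal_integral_eq_lintegral_ofReal hde (ae_of_all _ fun i => by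
      have := hd0 i
      simp only [Pi.zero_apply]
      positivity), integral_add hd (integrable_const _)]
  simp

/-- The conditional inequality tested on sets of the history. Extended nonnegative integrals make it
meaningful before Φ_{k+1} is known to be integrable, and the retained term with w^k - y^k later
yields summability. -/
theorem IsIterates.setLIntegral_lyapunov_succ_le
    (hiter : IsIterates A B C Bo lam γ x₀ ξ c x y w) (hs : IsSampling P Q p ξ c)
    (hA : MaximallyMonotone A) (hB : MonotoneOp B) (hC : Cocoercive β C) (hL : 0 ≤ L)
    (hBo : IsOracle Q Bo B L) (hlam : 0 ≤ lam ∧ lam < 1) (hp : 0 < p ∧ p ≤ 1) (hγ : 0 < γ)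
    (hδ : 0 < 1 - lam - γ ^ 2 * L ^ 2 - γ / (2 * β))
    {z : H} (hz : z ∈ solutionSet A B C) (k : ℕ) {S : Set Ω}
    (hS : MeasurableSet[history ξ w k] S) :
    ∫⁻ ω in S, ENNReal.ofReal (lyapunov lam p x w (k + 1) z ω) ∂P
      + ENNReal.ofReal (1 - lam - γ ^ 2 * L ^ 2 - γ / (2 * β))
        * ∫⁻ ω in S, ENNReal.ofReal (‖w k ω - y k ω‖ ^ 2) ∂P
      ≤ ∫⁻ ω in S, ENNReal.ofReal (lyapunov lam p x w k z ω) ∂P := by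
  have := UniformSpace.secondCountable_of_separable H
  set δ := 1 - lam - γ ^ 2 * L ^ 2 - γ / (2 * β) with hδdef
  have hBc := (hBo.lipschitzWith hL).continuous
  have hCc := hC.lipschitzWith.continuous
  have hle := hiter.history_le_past hA hγ hBc hCc hBo.measurable k
  have hm : history ξ w k ≤ mΩ := hle.trans (hs.past_le k)
  have hw : Measurable[history ξ w k] (w k) := measurable_history_w ξ w le_rfl
  have hx := hiter.measurable_history_x hA hγ hBc hCc hBo.measurable k
  have hy : Measurable[history ξ w k] (y k) :=
    hiter.measurable_y (m := history ξ w k) hA hγ hBc hCc hx hw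
  have hind := indep_of_indep_of_le_left (hs.indep_past k) hle
  -- Φ_{k+1} as a function of the frozen pair (w^k, y^k) and the fresh pair (ξ_k, c_k).
  let ψ : (H × H) × (I × Bool) → ENNReal := fun q =>
    ENNReal.ofReal (lam * ‖q.1.2 + γ • (Bo q.2.1 q.1.1 - Bo q.2.1 q.1.2) - z‖ ^ 2 + (1 - lam) / p *
      (if q.2.2 = true then ‖q.1.2 + γ • (Bo q.2.1 q.1.1 - Bo q.2.1 q.1.2) - z‖ ^ 2
        else ‖q.1.1 - z‖ ^ 2))
  have hdm : Measurable fun q : (H × H) × I =>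
      ‖q.1.2 + γ • (Bo q.2 q.1.1 - Bo q.2 q.1.2) - z‖ ^ 2 := by
    have h1 : Measurable fun q : (H × H) × I => Bo q.2 q.1.1 :=
      hBo.measurable.comp (measurable_snd.prodMk measurable_fst.fst)
    have h2 : Measurable fun q : (H × H) × I => Bo q.2 q.1.2 :=
      hBo.measurable.comp (measurable_snd.prodMk measurable_fst.snd)
    exact (((measurable_fst.snd.add ((h1.sub h2).const_smul γ)).sub_const z).norm).pow_const 2
  have hdm' : Measurable fun q : (H × H) × (I × Bool) =>
      ‖q.1.2 + γ • (Bo q.2.1 q.1.1 - Bo q.2.1 q.1.2) - z‖ ^ 2 :=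
    hdm.comp (measurable_fst.prodMk measurable_snd.fst)
  have hψ : Measurable ψ := by
    refine Measurable.ennreal_ofReal ((hdm'.const_mul _).add (Measurable.const_mul ?_ _))
    exact Measurable.ite (measurable_snd.snd (measurableSet_singleton true)) hdm'
      ((measurable_fst.fst.sub_const z).norm.pow_const 2)
  have h1 : ∀ ω, ENNReal.ofReal (lyapunov lam p x w (k + 1) z ω)
      = ψ ((w k ω, y k ω), (ξ k ω, c k ω)) := by
    intro ω
    simp only [lyapunov, ψ, hiter.step_w, hiter.step_x]
    congr 3
    split_ifs <;> rfl
  simp only [h1]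
  rw [setLIntegral_comp_prodMk_of_indep (X := fun ω => (w k ω, y k ω)) hm (hw.prodMk hy)
    ((hs.measurable_index k).prodMk (hs.measurable_coin k)) hind hψ hS,
    ← lintegral_const_mul' _ _ ENNReal.ofReal_ne_top,
    ← lintegral_add_right _ ?_]
  · refine lintegral_mono fun ω => ?_
    obtain ⟨hdi, hdle⟩ := hBo.integral_norm_sq_correction_le γ (w k ω) (y k ω) z
    have hstep := norm_sq_resolvent_step_le (L := L) hA hB hC hlam.1 hγ (hiter.step_y k ω) hz
    have hd0 : 0 ≤ ∫ i, ‖y k ω + γ • (Bo i (w k ω) - Bo i (y k ω)) - z‖ ^ 2 ∂Q :=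
      integral_nonneg fun i => sq_nonneg _
    have hlam1 : 0 < 1 - lam := sub_pos.2 hlam.2
    have hp0 := hp.1
    have hp1 : 0 ≤ 1 - p := sub_nonneg.2 hp.2
    have hdk : Measurable fun i => ‖y k ω + γ • (Bo i (w k ω) - Bo i (y k ω)) - z‖ ^ 2 :=
      hdm.comp (measurable_prodMk_left (x := (w k ω, y k ω)))
    simp only [ψ]
    rw [lintegral_step_le hs hp hlam (d := fun i =>
        ‖y k ω + γ • (Bo i (w k ω) - Bo i (y k ω)) - z‖ ^ 2) hdi
      hdk (fun i => sq_nonneg _) (sq_nonneg _),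
      ← ENNReal.ofReal_mul hδ.le, ← ENNReal.ofReal_add (by positivity) (by positivity)]
    refine ENNReal.ofReal_le_ofReal ?_
    have e : (1 - lam) / p * ‖w k ω - z‖ ^ 2
        = (1 - lam) * ‖w k ω - z‖ ^ 2 + (1 - lam) * (1 - p) / p * ‖w k ω - z‖ ^ 2 := by
      field_simp
      ring
    rw [lyapunov, e]
    linarith
  · have hw' : Measurable (w k) := hw.mono hm le_rfl
    have hy' : Measurable (y k) := hy.mono hm le_rfl
    exact ((hw'.sub hy').norm.pow_const 2).ennreal_ofReal.const_mul _

theorem IsIterates.lintegral_norm_sq_x_sub_y_le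
    (hiter : IsIterates A B C Bo lam γ x₀ ξ c x y w) (hs : IsSampling P Q p ξ c)
    (hA : MaximallyMonotone A) (hC : Cocoercive β C) (hL : 0 ≤ L)
    (hBo : IsOracle Q Bo B L) (hγ : 0 < γ) (k : ℕ) :
    ∫⁻ ω, ENNReal.ofReal (‖x (k + 1) ω - y k ω‖ ^ 2) ∂P
      ≤ ENNReal.ofReal (γ ^ 2 * L ^ 2) * ∫⁻ ω, ENNReal.ofReal (‖w k ω - y k ω‖ ^ 2) ∂P := by
  have := UniformSpace.secondCountable_of_separable H
  have hBc := (hBo.lipschitzWith hL).continuous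
  have hCc := hC.lipschitzWith.continuous
  have hm := hs.past_le k
  obtain ⟨hx, hw⟩ := hiter.measurable_past_x_w hA hγ hBc hCc hBo.measurable k
  have hy : Measurable[past ξ c k] (y k) :=
    hiter.measurable_y (m := past ξ c k) hA hγ hBc hCc hx hw
  have hind : Indep (past ξ c k) (MeasurableSpace.comap (ξ k) inferInstance) P :=
    indep_of_indep_of_le_right (hs.indep_past k)
      (Measurable.comap_le (measurable_fst.comp (comap_measurable _)))
  have hψ : Measurable fun q : (H × H) × I =>
      ENNReal.ofReal (γ ^ 2 * ‖Bo q.2 q.1.1 - Bo q.2 q.1.2‖ ^ 2) := by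
    have h1 : Measurable fun q : (H × H) × I => Bo q.2 q.1.1 :=
      hBo.measurable.comp (measurable_snd.prodMk measurable_fst.fst)
    have h2 : Measurable fun q : (H × H) × I => Bo q.2 q.1.2 :=
      hBo.measurable.comp (measurable_snd.prodMk measurable_fst.snd)
    exact ((h1.sub h2).norm.pow_const 2).const_mul _ |>.ennreal_ofReal
  have h1 : ∀ ω, ENNReal.ofReal (‖x (k + 1) ω - y k ω‖ ^ 2)
      = (fun q : (H × H) × I => ENNReal.ofReal (γ ^ 2 * ‖Bo q.2 q.1.1 - Bo q.2 q.1.2‖ ^ 2))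
        ((w k ω, y k ω), ξ k ω) := by
    intro ω
    simp only [hiter.step_x, add_sub_cancel_left, norm_smul, mul_pow, Real.norm_eq_abs, sq_abs]
  simp only [h1]
  have h2 := setLIntegral_comp_prodMk_of_indep (X := fun ω => (w k ω, y k ω)) hm (hw.prodMk hy)
    (hs.measurable_index k) hind hψ (S := Set.univ) MeasurableSet.univ
  simp only [Measure.restrict_univ] at h2
  rw [h2, ← lintegral_const_mul' _ _ ENNReal.ofReal_ne_top]
  refine lintegral_mono fun ω => ?_
  simp only [hs.law_index]
  rw [← ofReal_integral_eq_lintegral_ofReal ((hBo.integrable_sq _ _).const_mul _)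
    (ae_of_all _ fun i => by simp only [Pi.zero_apply]; positivity),
    ← ENNReal.ofReal_mul (by positivity), integral_const_mul, mul_assoc]
  refine ENNReal.ofReal_le_ofReal ?_
  gcongr
  exact hBo.lipschitz_in_mean _ _

end Decrease

/-! ### Convergence along a single path -/

section Path

theorem measurable_lyapunov {H : Type*} [NormedAddCommGroup H] [TopologicalSpace.SeparableSpace H]
    [MeasurableSpace H] [BorelSpace H] {Ω : Type*} {m : MeasurableSpace Ω} {lam p : ℝ}
    {x w : ℕ → Ω → H} {k : ℕ} (hx : Measurable (x k)) (hw : Measurable (w k)) (z : H) :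
    Measurable (lyapunov lam p x w k z) := by
  have := UniformSpace.secondCountable_of_separable H
  exact (((hx.sub_const z).norm.pow_const 2).const_mul _).add
    (((hw.sub_const z).norm.pow_const 2).const_mul _)

/-- Convergence of the Lyapunov function along a path on which `x` and `w` merge. -/
theorem exists_tendsto_norm_sub_of_lyapunov {H : Type*} [NormedAddCommGroup H] {Ω : Type*}
    {lam p : ℝ} {x w : ℕ → Ω → H} (hlam : 0 ≤ lam ∧ lam < 1) (hp : 0 < p) {z : H} {ω : Ω}
    (hΦ : ∃ ℓ, Tendsto (fun k => lyapunov lam p x w k z ω) atTop (𝓝 ℓ))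
    (hxw : Tendsto (fun k => x k ω - w k ω) atTop (𝓝 0)) :
    ∃ ℓ, Tendsto (fun k => ‖x k ω - z‖) atTop (𝓝 ℓ) := by
  obtain ⟨ℓ, hℓ⟩ := hΦ
  have hκ : 0 < (1 - lam) / p := div_pos (sub_pos.2 hlam.2) hp
  set κ := (1 - lam) / p with hκdef
  obtain ⟨M, hM⟩ := hℓ.bddAbove_range
  have hw : ∀ k, ‖w k ω - z‖ ≤ Real.sqrt (M / κ) := by
    intro k
    refine Real.le_sqrt_of_sq_le ?_
    rw [le_div_iff₀ hκ]
    have h1 : lyapunov lam p x w k z ω ≤ M := hM ⟨k, rfl⟩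
    have h2 : 0 ≤ lam * ‖x k ω - z‖ ^ 2 := mul_nonneg hlam.1 (sq_nonneg _)
    rw [lyapunov, ← hκdef] at h1
    linarith
  set R := Real.sqrt (M / κ) with hR
  have hdiff : Tendsto (fun k => ‖x k ω - z‖ ^ 2 - ‖w k ω - z‖ ^ 2) atTop (𝓝 0) := by
    refine squeeze_zero_norm
      (a := fun k => ‖x k ω - w k ω‖ * (‖x k ω - w k ω‖ + 2 * R)) (fun k => ?_) ?_
    · have h1 : |‖x k ω - z‖ - ‖w k ω - z‖| ≤ ‖x k ω - w k ω‖ := by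
        refine (abs_norm_sub_norm_le _ _).trans (le_of_eq ?_)
        rw [sub_sub_sub_cancel_right]
      have h2 : ‖x k ω - z‖ + ‖w k ω - z‖ ≤ ‖x k ω - w k ω‖ + 2 * R := by
        linarith [(abs_le.1 h1).2, hw k]
      rw [sq_sub_sq, Real.norm_eq_abs, abs_mul, mul_comm,
        abs_of_nonneg (a := ‖x k ω - z‖ + ‖w k ω - z‖) (by positivity)]
      gcongr
    · have := hxw.norm.mul (hxw.norm.add_const (2 * R))
      simpa using this
  have hs : 0 < lam + κ := by linarith [hlam.1]
  -- Here (λ+κ)‖x-z‖² = Φ + κ(‖x-z‖² - ‖w-z‖²). Since κ > 0, the case λ = 0 is included.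
  have hsq : Tendsto (fun k => ‖x k ω - z‖ ^ 2) atTop (𝓝 ((ℓ + κ * 0) / (lam + κ))) := by
    refine ((hℓ.add (hdiff.const_mul κ)).div_const (lam + κ)).congr fun k => ?_
    rw [lyapunov, ← hκdef, div_eq_iff hs.ne']
    ring
  refine ⟨_, hsq.sqrt.congr fun k => ?_⟩
  exact Real.sqrt_sq (norm_nonneg _)

variable {H : Type*} [NormedAddCommGroup H] [InnerProductSpace ℝ H]
  {I : Type*} {Ω : Type*} {A : H → Set H} {B C : H → H} {Bo : I → H → H} {lam γ : ℝ} {x₀ : H}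
  {ξ : ℕ → Ω → I} {c : ℕ → Ω → Bool} {x y w : ℕ → Ω → H}

/-- On a path on which the steps vanish, `x` and `w` merge. -/
theorem IsIterates.tendsto_x_sub_w (hiter : IsIterates A B C Bo lam γ x₀ ξ c x y w) {ω : Ω}
    (h1 : Tendsto (fun k => ‖w k ω - y k ω‖) atTop (𝓝 0))
    (h2 : Tendsto (fun k => ‖x (k + 1) ω - y k ω‖) atTop (𝓝 0)) :
    Tendsto (fun k => x k ω - w k ω) atTop (𝓝 0) := by
  -- After the shift, a true coin gives difference zero and a false one leaves x^{k+1} - w^k, which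
  -- is split at y^k.
  refine (tendsto_add_atTop_iff_nat 1).1
    (squeeze_zero_norm (fun k => ?_) (by simpa using h2.add h1))
  rw [hiter.step_w]
  split_ifs
  · rw [sub_self, norm_zero]
    positivity
  · rw [norm_sub_rev (w k ω)]
    refine le_of_eq_of_le ?_ (norm_add_le _ _)
    rw [sub_add_sub_cancel]

/-- Weak cluster points of `x` are solutions on a path on which the steps vanish. -/
theorem IsIterates.mem_solutionSet_of_weak_limit [CompleteSpace H]
    (hiter : IsIterates A B C Bo lam γ x₀ ξ c x y w) (hA : MaximallyMonotone A)
    (hB : MonotoneOp B) {KB KC : NNReal} (hBL : LipschitzWith KB B) (hC : MonotoneOp C)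
    (hCL : LipschitzWith KC C) (hγ : 0 < γ) {ω : Ω}
    (hwy : Tendsto (fun k => w k ω - y k ω) atTop (𝓝 0))
    (hxw : Tendsto (fun k => x k ω - w k ω) atTop (𝓝 0)) {R : ℝ} (hR : ∀ k, ‖x k ω‖ ≤ R)
    {l : Filter ℕ} [l.NeBot] (hl : l ≤ atTop) {v : H}
    (hv : ∀ h, Tendsto (fun k => ⟪x k ω, h⟫) l (𝓝 ⟪v, h⟫)) : v ∈ solutionSet A B C := by
  have hDL : LipschitzWith (KB + KC) (fun u => B u + C u) := hBL.add hCL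
  have hDm : MonotoneOp fun u => B u + C u := fun a b => by
    rw [add_sub_add_comm, inner_add_left]
    exact add_nonneg (hB a b) (hC a b)
  have hxy : Tendsto (fun k => x k ω - y k ω) atTop (𝓝 0) := by
    simpa using hxw.add hwy
  have hD : Tendsto (fun k => (B (w k ω) + C (w k ω)) - (B (y k ω) + C (y k ω))) atTop (𝓝 0) := by
    refine squeeze_zero_norm (a := fun k => (KB + KC : NNReal) * ‖w k ω - y k ω‖) (fun k => ?_) ?_
    · have := hDL.dist_le_mul (w k ω) (y k ω)
      rwa [dist_eq_norm, dist_eq_norm] at this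
    · simpa using hwy.norm.const_mul ((KB + KC : NNReal) : ℝ)
  -- The element of (A + B + C)(y^k) produced by the resolvent step; all its terms vanish in the
  -- limit.
  set u : ℕ → H := fun k => γ⁻¹ • (lam • (x k ω - y k ω) + (1 - lam) • (w k ω - y k ω))
    - ((B (w k ω) + C (w k ω)) - (B (y k ω) + C (y k ω))) with hu
  have hu0 : Tendsto u atTop (𝓝 0) := by
    have : Tendsto u atTop (𝓝 (γ⁻¹ • (lam • 0 + (1 - lam) • 0) - 0)) :=
      (((hxy.const_smul lam).add (hwy.const_smul (1 - lam))).const_smul γ⁻¹).sub hD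
    simpa using this
  obtain ⟨M, hM⟩ := hxy.norm.bddAbove_range
  have hyb : ∀ k, ‖y k ω‖ ≤ R + M := by
    intro k
    have h1 : ‖x k ω - y k ω‖ ≤ M := hM ⟨k, rfl⟩
    have h2 := norm_sub_le (x k ω) (x k ω - y k ω)
    rw [sub_sub_cancel] at h2
    linarith [hR k]
  have hyv : ∀ h, Tendsto (fun k => ⟪y k ω, h⟫) l (𝓝 ⟪v, h⟫) := by
    intro h
    have h1 : Tendsto (fun k => ⟪x k ω - y k ω, h⟫) l (𝓝 ⟪(0 : H), h⟫) :=
      (hxy.mono_left hl).inner tendsto_const_nhds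
    rw [inner_zero_left] at h1
    refine (((hv h).sub h1).congr fun k => ?_).trans (by rw [sub_zero])
    rw [← inner_sub_left, sub_sub_cancel]
  have hmem : ∀ k, ∃ a ∈ A (y k ω), a + (B (y k ω) + C (y k ω)) = u k := by
    intro k
    obtain ⟨a, ha, h⟩ := hiter.step_y k ω
    refine ⟨a, ha, ?_⟩
    have h' : a = γ⁻¹ •
        ((lam • x k ω + (1 - lam) • w k ω) - γ • (B (w k ω) + C (w k ω)) - y k ω) := by
      rw [← h, add_sub_cancel_left, inv_smul_smul₀ hγ.ne']
    have h3 : γ⁻¹ • γ • (B (w k ω) + C (w k ω)) = B (w k ω) + C (w k ω) := inv_smul_smul₀ hγ.ne' _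
    rw [sub_right_comm, smul_sub, h3] at h'
    simp only [hu]
    rw [h', show lam • x k ω + (1 - lam) • w k ω - y k ω
      = lam • (x k ω - y k ω) + (1 - lam) • (w k ω - y k ω) by module]
    abel
  obtain ⟨a, ha, h⟩ := hA.zero_mem_of_weak_limit hDL hDm hmem (hu0.mono_left hl) hyb hyv
  exact ⟨a, ha, by rw [add_assoc]; exact h⟩

end Path

end VRFBHF

/-! ### Assembly of the theorem -/

theorem theorem2p1
    {H : Type*} [NormedAddCommGroup H] [InnerProductSpace ℝ H] [CompleteSpace H]
    [TopologicalSpace.SeparableSpace H] [MeasurableSpace H] [BorelSpace H]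
    {I : Type*} [MeasurableSpace I] (Q : Measure I) [IsProbabilityMeasure Q]
    {Ω : Type*} [mΩ : MeasurableSpace Ω] (P : Measure Ω) [IsProbabilityMeasure P]
    (A : H → Set H) (B C : H → H) (Bo : I → H → H) (L β lam p γ : ℝ)
    (hA : VRFBHF.MaximallyMonotone A)
    (hB : VRFBHF.MonotoneOp B)
    (hL : 0 ≤ L) (hBo : VRFBHF.IsOracle Q Bo B L)
    (hC : VRFBHF.Cocoercive β C)
    (hZ : (VRFBHF.solutionSet A B C).Nonempty)
    (hlam : 0 ≤ lam ∧ lam < 1) (hp : 0 < p ∧ p ≤ 1)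
    (hγ : 0 < γ ∧
      γ < 4 * β * (1 - lam) / (1 + Real.sqrt (1 + 16 * β ^ 2 * L ^ 2 * (1 - lam))))
    (x₀ : H) (ξ : ℕ → Ω → I) (c : ℕ → Ω → Bool) (x y w : ℕ → Ω → H)
    (hsamp : VRFBHF.IsSampling P Q p ξ c)
    (hiter : VRFBHF.IsIterates A B C Bo lam γ x₀ ξ c x y w) :
    (∀ k, Measurable (x k) ∧ Measurable (w k)) ∧
    (∀ z ∈ VRFBHF.solutionSet A B C, ∀ k,
      Integrable (VRFBHF.lyapunov lam p x w k z) P ∧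
      P[VRFBHF.lyapunov lam p x w (k + 1) z | VRFBHF.history ξ w k]
        ≤ᵐ[P] VRFBHF.lyapunov lam p x w k z) ∧
    (∃ xlim : Ω → H, Measurable xlim ∧ (∀ ω, xlim ω ∈ VRFBHF.solutionSet A B C) ∧
      ∀ᵐ ω ∂P, Tendsto (fun k => toWeakSpace ℝ H (x k ω)) atTop
        (𝓝 (toWeakSpace ℝ H (xlim ω)))) := by
  open VRFBHF in
  have := UniformSpace.secondCountable_of_separable H
  have hδ := step_size_slack_pos (L := L) hC.1 hlam.2 hγ.1 hγ.2
  have hBL := hBo.lipschitzWith hL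
  have hCL := hC.lipschitzWith
  have hBc := hBL.continuous
  have hCc := hCL.continuous
  have hpast := fun k => hiter.history_le_past hA hγ.1 hBc hCc hBo.measurable k
  have hhist : ∀ k, history ξ w k ≤ mΩ := fun k => (hpast k).trans (hsamp.past_le k)
  have hxh := hiter.measurable_history_x hA hγ.1 hBc hCc hBo.measurable
  have hx : ∀ k, Measurable (x k) := fun k => (hxh k).mono (hhist k) le_rfl
  have hwh : ∀ k, Measurable[history ξ w k] (w k) := fun k => measurable_history_w ξ w le_rfl
  have hw : ∀ k, Measurable (w k) := fun k => (hwh k).mono (hhist k) le_rfl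
  have hy : ∀ k, Measurable (y k) := fun k => hiter.measurable_y hA hγ.1 hBc hCc (hx k) (hw k)
  let 𝒢 : Filtration ℕ mΩ := ⟨history ξ w, history_mono ξ w, hhist⟩
  have hdec := fun {z} (hz : z ∈ solutionSet A B C) k (S : Set Ω) (hS : MeasurableSet[𝒢 k] S) =>
    hiter.setLIntegral_lyapunov_succ_le hsamp hA hB hC hL hBo hlam hp hγ.1 hδ hz k hS
  have hnonneg := fun z k ω => lyapunov_nonneg (x := x) (w := w) hp.1 hlam k z ω
  have hint : ∀ z ∈ solutionSet A B C, ∀ k, Integrable (lyapunov lam p x w k z) P := by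
    intro z hz k
    refine (lintegral_ofReal_ne_top_iff_integrable
      (measurable_lyapunov (hx k) (hw k) z).aestronglyMeasurable (ae_of_all _ (hnonneg z k))).1 ?_
    -- Φ_0 is constant, and the decrease over the whole space carries finiteness of the integral
    -- from k to k + 1.
    induction k with
    | zero => simp [lyapunov, hiter.init_x, hiter.init_w]
    | succ k ih =>
      have h := le_self_add.trans (hdec hz k Set.univ MeasurableSet.univ)
      rw [Measure.restrict_univ] at h
      exact ne_top_of_le_ne_top ih h
  have hsup : ∀ z ∈ solutionSet A B C, Supermartingale (fun k => lyapunov lam p x w k z) 𝒢 P := by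
    intro z hz
    refine supermartingale_of_setLIntegral_le (hnonneg z) (fun k => ?_) (hint z hz)
      fun k S hS => le_self_add.trans (hdec hz k S hS)
    exact (measurable_lyapunov (m := history ξ w k) (hxh k) (hwh k) z).stronglyMeasurable
  refine ⟨fun k => ⟨hx k, hw k⟩,
    fun z hz k => ⟨hint z hz k, (hsup z hz).condExp_ae_le k.le_succ⟩, ?_⟩
  have hsum : ∑' k, ∫⁻ ω, ENNReal.ofReal (‖w k ω - y k ω‖ ^ 2) ∂P ≠ ⊤ := by
    obtain ⟨z, hz⟩ := hZ
    have h := tsum_le_of_add_le fun k => hdec hz k Set.univ MeasurableSet.univ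
    simp only [Measure.restrict_univ] at h
    rw [ENNReal.tsum_mul_left] at h
    have h2 := ne_top_of_le_ne_top (hint z hz 0).lintegral_lt_top.ne h
    intro htop
    rw [htop, ENNReal.mul_top (ENNReal.ofReal_pos.2 hδ).ne'] at h2
    exact h2 rfl
  have hsum' : ∑' k, ∫⁻ ω, ENNReal.ofReal (‖x (k + 1) ω - y k ω‖ ^ 2) ∂P ≠ ⊤ := by
    have h := ENNReal.tsum_le_tsum fun k =>
      hiter.lintegral_norm_sq_x_sub_y_le hsamp hA hC hL hBo hγ.1 k
    rw [ENNReal.tsum_mul_left] at h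
    exact ne_top_of_le_ne_top (ENNReal.mul_ne_top ENNReal.ofReal_ne_top hsum) h
  -- Countability of D allows one null set for all its points; density later extends convergence to
  -- all solutions.
  obtain ⟨D, hDZ, hDc, hDd⟩ :=
    (TopologicalSpace.IsSeparable.of_separableSpace (solutionSet A B C)).exists_countable_dense_subset
  have hconvD : ∀ᵐ ω ∂P, ∀ z ∈ D, ∃ ℓ, Tendsto (fun k => lyapunov lam p x w k z ω) atTop (𝓝 ℓ) :=
    (ae_ball_iff hDc).2 fun z hz => supermartingale_exists_ae_tendsto (hnonneg z) (hsup z (hDZ hz))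
  have hlim : ∀ᵐ ω ∂P, ∃ v ∈ solutionSet A B C,
      ∀ h, Tendsto (fun k => ⟪x k ω, h⟫) atTop (𝓝 ⟪v, h⟫) := by
    filter_upwards [hconvD,
      ae_tendsto_zero_of_tsum_lintegral_ne_top (fun k => ((hw k).sub (hy k)).norm)
        (fun k ω => norm_nonneg _) hsum,
      ae_tendsto_zero_of_tsum_lintegral_ne_top (fun k => ((hx (k + 1)).sub (hy k)).norm)
        (fun k ω => norm_nonneg _) hsum'] with ω hΦ h1 h2
    have hxw := hiter.tendsto_x_sub_w h1 h2
    have hconv : ∀ z ∈ solutionSet A B C, ∃ ℓ, Tendsto (fun k => ‖x k ω - z‖) atTop (𝓝 ℓ) :=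
      fun z hz => exists_tendsto_norm_sub_of_subset_closure
        (fun z hz => exists_tendsto_norm_sub_of_lyapunov hlam hp.1 (hΦ z hz) hxw) (hDd hz)
    obtain ⟨R, hR⟩ := exists_norm_le_of_tendsto_norm_sub (hconv _ hZ.some_mem)
    exact exists_weak_limit_of_opial hZ hconv fun U hU v hv =>
      hiter.mem_solutionSet_of_weak_limit hA hB hBL hC.monotone hCL hγ.1
        (tendsto_zero_iff_norm_tendsto_zero.2 h1) hxw hR hU hv
  obtain ⟨xlim, hm, hmem, hxlim⟩ := exists_measurable_weak_limit hZ hx hlim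
  refine ⟨xlim, hm, hmem, ?_⟩
  filter_upwards [hxlim] with ω hω
  exact tendsto_toWeakSpace_iff.2 hω
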